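/- **Setting.** Let $\mathcal H$ be a complex Hilbert space and $\{\rho_{\theta,\xi}\}_{\theta\in\Theta,\xi\in\Xi}$ a family of quantum states (positive operators of trace one) on $\mathcal H$, with $\Theta=\Theta_0\sqcup\Theta_1$ and a nonempty set $\Xi$ of disturbance parameters. Let $\alpha\in(0,1)$. In the testing problem $H_0:\theta\in\Theta_0$ vs. $H_1:\theta\in\Theta_1$ with this family, a *test* is an operator $0\le T\le I$, with type II error probability $\beta_T(\rho)=1-\mathrm{Tr}(\rho T)$. It has *level* $\alpha$ if $\mathrm{Tr}(\rho_{\theta,\xi}T)\le\alpha$ for all $\theta\in\Theta_0,\xi\in\Xi$. A test with level $\alpha$ is *unbiased* if $\beta_T(\rho_{\theta,\xi})\le 1-\alpha$ for all $\theta\in\Theta_1,\xi\in\Xi$. Let $\mathcal T$ be the set of tests with level $\alpha$ (respectively, of unbiased tests with level $\alpha$). A test $T\in\mathcal T$ is a *UMP* (respectively *UMP unbiased*) *test with level $\alpha$* if $\beta_T(\rho_{\theta,\xi})\le\beta_{T'}(\rho_{\theta,\xi})$ for all $T'\in\mathcal T$, $\theta\in\Theta_1$, $\xi\in\Xi$.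 It is a *UMP min-max* (respectively *UMP unbiased min-max*) *test with level $\alpha$* if $\sup_{\xi\in\Xi}\beta_T(\rho_{\theta,\xi})=\inf_{T'\in\mathcal T}\sup_{\xi\in\Xi}\beta_{T'}(\rho_{\theta,\xi})$ for all $\theta\in\Theta_1$. A family $\mathcal S$ of states is *complete* if, for every bounded operator $X$, one has $\mathrm{Tr}(\rho X)=0$ for all $\rho\in\mathcal S$ if and only if $X=0$. A projective unitary representation $V$ of a topological group $G$ on $\mathcal H$ is a map $g\mapsto V_g$ into the unitary operators that is multiplicative up to phase factors and for which $g\mapsto|\langle x,V_gy\rangle|$ is continuous for all $x,y$. It is irreducible if $\mathcal H\neq0$ and the only closed invariant subspaces are $0$ and $\mathcal H$. **Theorem.** Let $\mathcal H_1,\mathcal H_2,\mathcal H_3$ be complex Hilbert spaces of at most countable dimension, let $\Xi_1,\Xi_2,\Xi_3$ be nonempty sets, and let $\{\rho_{\theta,\xi_1}\}_{\theta\in\Theta,\xi_1\in\Xi_1}$, $\{\rho_{\xi_2}\}_{\xi_2\in\Xi_2}$, $\{\rho_{\theta,\xi_1,\xi_3}\}_{\theta\in\Theta,\xi_1\in\Xi_1,\xi_3\in\Xi_3}$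 be families of states on $\mathcal H_1,\mathcal H_2,\mathcal H_3$, respectively. Let $\Theta=\Theta_0\sqcup\Theta_1$ and $\alpha\in(0,1)$. (1) Let $V$ be an irreducible projective unitary representation on $\mathcal H_3$ of an amenable locally compact Hausdorff group $G$. Assume that $G$ acts on $\Xi_1\times\Xi_3$ in such a way that, for all $g\in G$ and $(\xi_1,\xi_3)\in\Xi_1\times\Xi_3$, with $(\xi_1',\xi_3')=g\cdot(\xi_1,\xi_3)$, $$V_g\,\rho_{\theta,\xi_1,\xi_3}V_g^*=\rho_{\theta,\xi_1',\xi_3'}\quad\text{and}\quad \rho_{\theta,\xi_1'}=\rho_{\theta,\xi_1}\qquad\text{for all }\theta\in\Theta$$ (equivalently, $I\otimes V$ is covariant for the product family $\{\rho_{\theta,\xi_1}\otimes\rho_{\theta,\xi_1,\xi_3}\}$ with respect to $\Xi_1\times\Xi_3$). If $G$ is not compact, assume in addition that the family $\{\rho_{\theta,\xi_1}\otimes\rho_{\theta,\xi_1,\xi_3}\}_{\theta\in\Theta,\xi_1\in\Xi_1,\xi_3\in\Xi_3}$ is complete. Let $U$ be a unitary operator on $\mathcal H_1\otimes\mathcal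 H_2\otimes\mathcal H_3$ and $T$ a bounded operator on $\mathcal H_1$. Then $T$ is a UMP min-max test with level $\alpha$ for $H_0:\theta\in\Theta_0$ vs. $H_1:\theta\in\Theta_1$ with $\{\rho_{\theta,\xi_1}\}_{\theta,\xi_1}$ (disturbance parameter $\xi_1$) if and only if $U^*(T\otimes I\otimes I)U$ is a UMP min-max test with level $\alpha$ for $H_0:\theta\in\Theta_0$ vs. $H_1:\theta\in\Theta_1$ with $\{U^*(\rho_{\theta,\xi_1}\otimes\rho_{\xi_2}\otimes\rho_{\theta,\xi_1,\xi_3})U\}_{\theta,\xi_1,\xi_2,\xi_3}$ (disturbance parameter $(\xi_1,\xi_2,\xi_3)$). The same equivalence holds with "UMP unbiased min-max" in place of "UMP min-max" on both sides. (2) (The case without third system.) Let $U'$ be a unitary operator on $\mathcal H_1\otimes\mathcal H_2$ and $T$ a bounded operator on $\mathcal H_1$. Then $T$ is a UMP test with level $\alpha$ for $H_0:\theta\in\Theta_0$ vs. $H_1:\theta\in\Theta_1$ with $\{\rho_{\theta,\xi_1}\}_{\theta,\xi_1}$ if and only if $U'^*(T\otimes I)U'$ is a UMP test with level $\alpha$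 for $H_0:\theta\in\Theta_0$ vs. $H_1:\theta\in\Theta_1$ with $\{U'^*(\rho_{\theta,\xi_1}\otimes\rho_{\xi_2})U'\}_{\theta,\xi_1,\xi_2}$. The same equivalence holds with "UMP" replaced on both sides by "UMP unbiased", by "UMP min-max", or by "UMP unbiased min-max". -/

import Mathlib

open scoped TensorProduct ComplexOrder BoundedContinuousFunction

noncomputable section

/-! ### Hilbert space tensor products -/

/-- The tensor product of two complex Hilbert spaces: the completion of the algebraic tensor
product for the inner product with `⟪x ⊗ y, x' ⊗ y'⟫ = ⟪x, x'⟫ * ⟪y, y'⟫`. -/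
abbrev HilbertTensor (E F : Type*) [NormedAddCommGroup E] [InnerProductSpace ℂ E]
    [NormedAddCommGroup F] [InnerProductSpace ℂ F] : Type _ :=
  UniformSpace.Completion (E ⊗[ℂ] F)

/-- The tensor product `A ⊗ B` of two bounded operators: the bounded operator on the Hilbert space
tensor product with `(A ⊗ B) (x ⊗ y) = A x ⊗ B y`. -/
def opTensor {E F : Type*} [NormedAddCommGroup E] [InnerProductSpace ℂ E]
    [NormedAddCommGroup F] [InnerProductSpace ℂ F] (A : E →L[ℂ] E) (B : F →L[ℂ] F) :
    HilbertTensor E F →L[ℂ] HilbertTensor E F :=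
  (TensorProduct.mapL A B).completion

theorem opTensor_coe_tmul {E F : Type*} [NormedAddCommGroup E] [InnerProductSpace ℂ E]
    [NormedAddCommGroup F] [InnerProductSpace ℂ F] (A : E →L[ℂ] E) (B : F →L[ℂ] F)
    (x : E) (y : F) :
    opTensor A B ((x ⊗ₜ[ℂ] y : E ⊗[ℂ] F) : HilbertTensor E F) =
      ((A x ⊗ₜ[ℂ] B y : E ⊗[ℂ] F) : HilbertTensor E F) := by
  simp [opTensor]

/-! ### Trace and quantum states -/

section Trace

variable (H : Type*) [NormedAddCommGroup H] [InnerProductSpace ℂ H] [CompleteSpace H]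

/-- The index set of a fixed orthonormal basis of `H`. -/
def stdIndex : Set H := (exists_hilbertBasis ℂ H).choose

/-- A fixed orthonormal basis of `H`, used to compute traces. -/
def stdBasis : HilbertBasis (stdIndex H) ℂ H := (exists_hilbertBasis ℂ H).choose_spec.choose

variable {H}

/-- The trace `∑ i, ⟪e i, A (e i)⟫`. It is only applied to trace class operators, for which the
series converges absolutely and its sum does not depend on the orthonormal basis. -/
def opTrace (A : H →L[ℂ] H) : ℂ := ∑' i, inner ℂ (stdBasis H i) (A (stdBasis H i))

/-- A quantum state (density operator): a positive operator of trace one. (The trace of a positive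
operator, finite or infinite, does not depend on the orthonormal basis; a positive operator is of
trace class exactly when its trace is finite.) -/
def IsState (ρ : H →L[ℂ] H) : Prop :=
  ρ.IsPositive ∧ HasSum (fun i => inner ℂ (stdBasis H i) (ρ (stdBasis H i))) 1

/-- A family of states is complete if a bounded operator `X` vanishes exactly when
`Tr (ρ X) = 0` for all members `ρ` of the family. -/
def IsCompleteFamily {ι : Type*} (ρ : ι → H →L[ℂ] H) : Prop :=
  ∀ X : H →L[ℂ] H, (∀ i, opTrace (ρ i * X) = 0) ↔ X = 0

end Trace

/-! ### Hypothesis testing -/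

section Testing

variable {H : Type*} [NormedAddCommGroup H] [InnerProductSpace ℂ H] [CompleteSpace H]
variable {Θ Ξ : Type*}

/-- A test (operator): `0 ≤ T ≤ I`. -/
def IsTest (T : H →L[ℂ] H) : Prop := 0 ≤ T ∧ T ≤ 1

/-- The probability `Tr (ρ T)` of rejecting the null hypothesis. -/
def rejectProb (ρ T : H →L[ℂ] H) : ℝ := (opTrace (ρ * T)).re

/-- The type II error probability `β_T(ρ) = 1 - Tr (ρ T)`. -/
def typeIIError (ρ T : H →L[ℂ] H) : ℝ := 1 - rejectProb ρ T

/-- The tests with level `α` for the null hypothesis `θ ∈ Θ₀` in the family `ρ θ ξ`, where `ξ` is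
the disturbance parameter. -/
def levelTests (Θ₀ : Set Θ) (ρ : Θ → Ξ → H →L[ℂ] H) (α : ℝ) : Set (H →L[ℂ] H) :=
  {T | IsTest T ∧ ∀ θ ∈ Θ₀, ∀ ξ, rejectProb (ρ θ ξ) T ≤ α}

/-- The unbiased tests with level `α` for `H₀ : θ ∈ Θ₀` against `H₁ : θ ∈ Θ₁`. -/
def unbiasedTests (Θ₀ Θ₁ : Set Θ) (ρ : Θ → Ξ → H →L[ℂ] H) (α : ℝ) : Set (H →L[ℂ] H) :=
  {T | T ∈ levelTests Θ₀ ρ α ∧ ∀ θ ∈ Θ₁, ∀ ξ, typeIIError (ρ θ ξ) T ≤ 1 - α}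

/-- `T` is uniformly most powerful in the class `𝒯` of tests. -/
def IsUMPIn (𝒯 : Set (H →L[ℂ] H)) (Θ₁ : Set Θ) (ρ : Θ → Ξ → H →L[ℂ] H) (T : H →L[ℂ] H) : Prop :=
  T ∈ 𝒯 ∧ ∀ T' ∈ 𝒯, ∀ θ ∈ Θ₁, ∀ ξ, typeIIError (ρ θ ξ) T ≤ typeIIError (ρ θ ξ) T'

/-- `T` is optimal in the class `𝒯` of tests for the min-max criterion with respect to the
disturbance parameter. (For tests and states the error probabilities lie in `[0, 1]`.) -/
def IsMinMaxIn (𝒯 : Set (H →L[ℂ] H)) (Θ₁ : Set Θ) (ρ : Θ → Ξ → H →L[ℂ] H)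
    (T : H →L[ℂ] H) : Prop :=
  T ∈ 𝒯 ∧ ∀ θ ∈ Θ₁,
    ⨆ ξ, typeIIError (ρ θ ξ) T = ⨅ T' : 𝒯, ⨆ ξ, typeIIError (ρ θ ξ) (T' : H →L[ℂ] H)

/-- `T` is a UMP test with level `α`. -/
def IsUMP (Θ₀ Θ₁ : Set Θ) (α : ℝ) (ρ : Θ → Ξ → H →L[ℂ] H) (T : H →L[ℂ] H) : Prop :=
  IsUMPIn (levelTests Θ₀ ρ α) Θ₁ ρ T

/-- `T` is a UMP unbiased test with level `α`. -/
def IsUMPUnbiased (Θ₀ Θ₁ : Set Θ) (α : ℝ) (ρ : Θ → Ξ → H →L[ℂ] H) (T : H →L[ℂ] H) : Prop :=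
  IsUMPIn (unbiasedTests Θ₀ Θ₁ ρ α) Θ₁ ρ T

/-- `T` is a UMP min-max test with level `α`. -/
def IsUMPMinMax (Θ₀ Θ₁ : Set Θ) (α : ℝ) (ρ : Θ → Ξ → H →L[ℂ] H) (T : H →L[ℂ] H) : Prop :=
  IsMinMaxIn (levelTests Θ₀ ρ α) Θ₁ ρ T

/-- `T` is a UMP unbiased min-max test with level `α`. -/
def IsUMPUnbiasedMinMax (Θ₀ Θ₁ : Set Θ) (α : ℝ) (ρ : Θ → Ξ → H →L[ℂ] H)
    (T : H →L[ℂ] H) : Prop :=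
  IsMinMaxIn (unbiasedTests Θ₀ Θ₁ ρ α) Θ₁ ρ T

/-- `U* A U`. -/
def unitaryConj (U : unitary (H →L[ℂ] H)) (A : H →L[ℂ] H) : H →L[ℂ] H :=
  star (U : H →L[ℂ] H) * A * (U : H →L[ℂ] H)

end Testing

/-! ### Amenable groups and projective representations -/

/-- A (locally compact) topological group is amenable if there is a left invariant mean on its
bounded continuous real functions. -/
def IsAmenable (G : Type*) [Group G] [TopologicalSpace G] [ContinuousMul G] : Prop :=
  ∃ m : (G →ᵇ ℝ) →ₗ[ℝ] ℝ,
    (∀ f : G →ᵇ ℝ, (∀ x, 0 ≤ f x) → 0 ≤ m f) ∧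
    m (BoundedContinuousFunction.const G 1) = 1 ∧
    ∀ (g : G) (f : G →ᵇ ℝ), m (f.compContinuous (ContinuousMap.mulLeft g)) = m f

section Representation

variable {G : Type*} [Group G]
variable {H : Type*} [NormedAddCommGroup H] [InnerProductSpace ℂ H] [CompleteSpace H]

/-- `V` is a continuous projective unitary representation of `G` on `H`: each `V g` is unitary,
`V` is multiplicative up to phase factors, and `g ↦ |⟪x, V g y⟫|` is continuous for all `x`, `y`
(which is the continuity of `g ↦ V g` as a map to the projective unitary group). Every strongly
continuous unitary representation is of this form. -/
structure IsProjectiveUnitaryRep [TopologicalSpace G] (V : G → H →L[ℂ] H) : Prop where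
  unitary_mem : ∀ g, V g ∈ unitary (H →L[ℂ] H)
  map_mul : ∀ g h, ∃ c : ℂ, ‖c‖ = 1 ∧ V (g * h) = c • (V g * V h)
  continuous_norm_inner : ∀ x y : H, Continuous fun g => ‖inner ℂ x (V g y)‖

/-- Irreducibility: `H ≠ 0`, and `0` and `H` are the only closed invariant subspaces. -/
def IsIrreducibleRep (V : G → H →L[ℂ] H) : Prop :=
  Nontrivial H ∧ ∀ K : Submodule ℂ H, IsClosed (K : Set H) →
    (∀ g, ∀ x ∈ K, V g x ∈ K) → K = ⊥ ∨ K = ⊤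

/-- `V` is covariant with respect to the disturbance parameter `ξ` of the family `ρ θ ξ`, for the
given action of `G` on the disturbance parameter space. -/
def IsCovariant {Θ Ξ : Type*} [MulAction G Ξ] (V : G → H →L[ℂ] H) (ρ : Θ → Ξ → H →L[ℂ] H) :
    Prop :=
  ∀ g θ ξ, V g * ρ θ ξ * star (V g) = ρ θ (g • ξ)

end Representation

end

/-! The map `T ↦ U* (T ⊗ 1 ⊗ 1) U` embeds the tests of the small problem into those of the large one
and preserves all rejection probabilities. The content is the reverse direction: a test `T'` of the
large problem must yield a test `S` on the first system whose rejection probability at each `(θ,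
ξ₁)` lies between the extremes, over the disturbance parameter, of those of `T'` at the same `θ`
(`IsIntermediate`). Such an `S` inherits level and unbiasedness, and its worst type II error is no
larger, so the min-max values agree (`IsTestEmbedding.isMinMaxIn_iff`).

The second system is removed by a partial trace against one fixed `ρ₂ ξ₂` (`exists_partial_test`).
Since `ρ₂` does not depend on `θ`, rejection probabilities are reproduced exactly, which also
settles the plain UMP criteria.

The third state depends on `θ` and cannot be frozen. Instead, as in the Hunt–Stein theorem, `T'` is
averaged over the orbit of `V` with an invariant mean (`IsAmenable.exists_averaged_test`). The
average commutes with `V`, so by irreducibility it acts on the third factor as a scalar and leaves a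
test on the other factors. Covariance identifies the averaged quantities with rejection
probabilities at other disturbance parameters, and a mean lies between the extremes. The mean is
only finitely additive; it passes through the sums defining states because these converge in sup
norm. -/

/-! ### Tensor products of vectors and operators -/

section HilbertTensor

variable {E F : Type*} [NormedAddCommGroup E] [InnerProductSpace ℂ E]
  [NormedAddCommGroup F] [InnerProductSpace ℂ F]

/-- The elementary tensor `x ⊗ y` as a continuous bilinear map into the Hilbert space tensor
product. -/
noncomputable def hilbertTmul : E →L[ℂ] F →L[ℂ] HilbertTensor E F :=
  (ContinuousLinearMap.compL ℂ F (E ⊗[ℂ] F) (HilbertTensor E F)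
    UniformSpace.Completion.toComplL).comp (TensorProduct.mkL ℂ E F)

theorem hilbertTmul_apply (x : E) (y : F) :
    hilbertTmul x y = ((x ⊗ₜ[ℂ] y : E ⊗[ℂ] F) : HilbertTensor E F) := rfl

@[simp]
theorem inner_hilbertTmul (x x' : E) (y y' : F) :
    inner ℂ (hilbertTmul x y) (hilbertTmul x' y') = inner ℂ x x' * inner ℂ y y' := by
  simp [hilbertTmul_apply, UniformSpace.Completion.inner_coe]

@[simp]
theorem norm_hilbertTmul (x : E) (y : F) : ‖hilbertTmul x y‖ = ‖x‖ * ‖y‖ := by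
  simp [hilbertTmul_apply]

@[simp]
theorem opTensor_hilbertTmul (A : E →L[ℂ] E) (B : F →L[ℂ] F) (x : E) (y : F) :
    opTensor A B (hilbertTmul x y) = hilbertTmul (A x) (B y) :=
  opTensor_coe_tmul A B x y

theorem hilbertTensor_hom_ext {X : Type*} [NormedAddCommGroup X] [NormedSpace ℂ X]
    {A B : HilbertTensor E F →L[ℂ] X}
    (h : ∀ x y, A (hilbertTmul x y) = B (hilbertTmul x y)) : A = B := by
  ext z
  induction z using UniformSpace.Completion.induction_on with
  | hp => exact isClosed_eq A.continuous B.continuous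
  | ih z =>
    induction z with
    | zero => rw [UniformSpace.Completion.coe_zero, map_zero, map_zero]
    | tmul x y => exact h x y
    | add x y hx hy => rw [UniformSpace.Completion.coe_add, map_add, map_add, hx, hy]

theorem opTensor_add_left (A A' : E →L[ℂ] E) (B : F →L[ℂ] F) :
    opTensor (A + A') B = opTensor A B + opTensor A' B :=
  hilbertTensor_hom_ext fun _ _ => by simp

theorem opTensor_mul (A A' : E →L[ℂ] E) (B B' : F →L[ℂ] F) :
    opTensor A B * opTensor A' B' = opTensor (A * A') (B * B') :=
  hilbertTensor_hom_ext fun _ _ => by simp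

@[simp]
theorem opTensor_one : opTensor (1 : E →L[ℂ] E) (1 : F →L[ℂ] F) = 1 :=
  hilbertTensor_hom_ext fun _ _ => by simp

theorem star_opTensor [CompleteSpace E] [CompleteSpace F] (A : E →L[ℂ] E) (B : F →L[ℂ] F) :
    star (opTensor A B) = opTensor (star A) (star B) := by
  refine hilbertTensor_hom_ext fun x y => (innerSL_inj (𝕜 := ℂ)).1 ?_
  refine hilbertTensor_hom_ext fun x' y' => ?_
  simp [ContinuousLinearMap.star_eq_adjoint, ContinuousLinearMap.adjoint_inner_left]

end HilbertTensor

/-! ### States as ensembles of vectors -/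

section Ensemble

open InnerProductSpace in
/-- The operator `ρ` is the mixture `∑ i, |v i⟩⟨v i|` of the unnormalized vectors `v i`, whose
total mass `∑ i, ‖v i‖ ^ 2` is one. -/
structure IsEnsemble {ι H : Type*} [NormedAddCommGroup H] [InnerProductSpace ℂ H]
    (v : ι → H) (ρ : H →L[ℂ] H) : Prop where
  hasSum_norm_sq : HasSum (fun i => ‖v i‖ ^ 2) 1
  hasSum_rankOne : HasSum (fun i => rankOne ℂ (v i) (v i)) ρ

variable {ι κ H E F : Type*} [NormedAddCommGroup H] [InnerProductSpace ℂ H]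
  [NormedAddCommGroup E] [InnerProductSpace ℂ E] [NormedAddCommGroup F] [InnerProductSpace ℂ F]

theorem summable_rankOne_self [CompleteSpace H] {v : ι → H} (hv : Summable fun i => ‖v i‖ ^ 2) :
    Summable fun i => InnerProductSpace.rankOne ℂ (v i) (v i) :=
  .of_norm (by simpa [sq] using hv)

/-- The vectors are `√ρ eᵢ`, and Parseval gives `∑ |√ρ eᵢ⟩⟨√ρ eᵢ| = √ρ √ρ = ρ`. Ensembles replace
traces throughout: they are stable under tensor products and unitary conjugation, and turn rejection
probabilities into sums of vector expectations. -/
theorem IsState.exists_isEnsemble [CompleteSpace H] {ρ : H →L[ℂ] H} (hρ : IsState ρ) :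
    ∃ v : stdIndex H → H, IsEnsemble v ρ := by
  have h0 : 0 ≤ ρ := (ContinuousLinearMap.nonneg_iff_isPositive ρ).2 hρ.1
  have hs : IsSelfAdjoint (CFC.sqrt ρ) := (CFC.sqrt_nonneg ρ).isSelfAdjoint
  have hin : ∀ x y, inner ℂ (CFC.sqrt ρ x) (CFC.sqrt ρ y) = inner ℂ x (ρ y) := fun x y => by
    rw [hs.isSymmetric.apply_clm, ← mul_apply_eq_comp, CFC.sqrt_mul_sqrt_self ρ h0]
  have hn : HasSum (fun i => ‖CFC.sqrt ρ (stdBasis H i)‖ ^ 2) 1 := by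
    have := Complex.hasSum_re hρ.2
    refine this.congr_fun fun i => ?_
    rw [← hin, inner_self_eq_norm_sq_to_K]
    norm_cast
  refine ⟨fun i => CFC.sqrt ρ (stdBasis H i), hn, ?_⟩
  have hsum := summable_rankOne_self hn.summable
  convert hsum.hasSum
  refine ContinuousLinearMap.ext fun y => ext_inner_left ℂ fun x => ?_
  have h1 : HasSum (fun i => inner ℂ x (InnerProductSpace.rankOne ℂ (CFC.sqrt ρ (stdBasis H i))
      (CFC.sqrt ρ (stdBasis H i)) y)) _ :=
    (hsum.hasSum.mapL (ContinuousLinearMap.apply ℂ H y)).mapL (innerSL ℂ x)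
  refine HasSum.unique ?_ h1
  rw [← hin]
  refine ((stdBasis H).hasSum_inner_mul_inner _ _).congr_fun fun i => ?_
  simp [mul_comm, hs.isSymmetric.apply_clm]

theorem HasSum.inner_right {f : ι → H} {a : H} (h : HasSum f a) (x : H) :
    HasSum (fun i => (inner ℂ x (f i) : ℂ)) (inner ℂ x a) :=
  ContinuousLinearMap.hasSum (innerSL ℂ x) h

theorem IsEnsemble.hasSum_apply {v : ι → H} {ρ : H →L[ℂ] H} (hv : IsEnsemble v ρ) (x : H) :
    HasSum (fun i => (inner ℂ (v i) x : ℂ) • v i) (ρ x) :=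
  hv.hasSum_rankOne.mapL (ContinuousLinearMap.apply ℂ H x)

/-- Finite total mass already makes the rank-one series converge in norm, so pointwise convergence
only has to identify the limit. -/
theorem isEnsemble_of_hasSum_apply [CompleteSpace H] {v : ι → H} {ρ : H →L[ℂ] H}
    (hn : HasSum (fun i => ‖v i‖ ^ 2) 1)
    (h : ∀ x, HasSum (fun i => (inner ℂ (v i) x : ℂ) • v i) (ρ x)) : IsEnsemble v ρ := by
  refine ⟨hn, ?_⟩
  have hs := summable_rankOne_self hn.summable
  convert hs.hasSum
  ext x
  exact (h x).unique (hs.hasSum.mapL (ContinuousLinearMap.apply ℂ H x))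

theorem IsEnsemble.tmul {v : ι → E} {w : κ → F}
    {A : E →L[ℂ] E} {B : F →L[ℂ] F} (hv : IsEnsemble v A) (hw : IsEnsemble w B) :
    IsEnsemble (fun i : ι × κ => hilbertTmul (v i.1) (w i.2)) (opTensor A B) := by
  have hn : HasSum (fun i : ι × κ => ‖hilbertTmul (v i.1) (w i.2)‖ ^ 2) 1 := by
    have := hv.hasSum_norm_sq.mul hw.hasSum_norm_sq
      (hv.hasSum_norm_sq.summable.mul_of_nonneg hw.hasSum_norm_sq.summable
        (fun _ => sq_nonneg _) fun _ => sq_nonneg _)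
    simpa [mul_pow] using this
  refine isEnsemble_of_hasSum_apply hn fun z => ?_
  have hs := summable_rankOne_self hn.summable
  have h := fun z => hs.hasSum.mapL (ContinuousLinearMap.apply ℂ (HilbertTensor E F) z)
  -- The series has a bounded operator as its limit, so it suffices to compare on elementary
  -- tensors, where the double sum is evaluated one index at a time.
  have key : opTensor A B = ∑' i : ι × κ, InnerProductSpace.rankOne ℂ
      (hilbertTmul (v i.1) (w i.2)) (hilbertTmul (v i.1) (w i.2)) := by
    refine hilbertTensor_hom_ext fun x y => ?_
    rw [opTensor_hilbertTmul]
    refine HasSum.unique ((hv.hasSum_apply x).mapL ((hilbertTmul (E := E)).flip (B y)))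
      ((h (hilbertTmul x y)).prod_fiberwise fun i => ?_)
    refine ((hw.hasSum_apply y).mapL (hilbertTmul ((inner ℂ (v i) x : ℂ) • v i))).congr_fun
      fun j => ?_
    simp [smul_smul, mul_comm]
  rw [key]
  exact h z

theorem IsEnsemble.conj [CompleteSpace H] {v : ι → H} {ρ : H →L[ℂ] H} (hv : IsEnsemble v ρ)
    {U : H →L[ℂ] H} (hU : U ∈ unitary (H →L[ℂ] H)) :
    IsEnsemble (fun i => U (v i)) (U * ρ * star U) := by
  refine isEnsemble_of_hasSum_apply ?_ fun x => ?_
  · simpa only [ContinuousLinearMap.norm_map_of_mem_unitary hU] using hv.hasSum_norm_sq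
  · refine ((hv.hasSum_apply (star U x)).mapL U).congr_fun fun i => ?_
    simp [ContinuousLinearMap.star_eq_adjoint, ContinuousLinearMap.adjoint_inner_right]

theorem HilbertBasis.hasSum_norm_inner_sq (e : HilbertBasis κ ℂ H) (x : H) :
    HasSum (fun j => ‖(inner ℂ (e j) x : ℂ)‖ ^ 2) (‖x‖ ^ 2) := by
  have := Complex.hasSum_re (e.hasSum_inner_mul_inner x x)
  have h2 : (inner ℂ x x : ℂ).re = ‖x‖ ^ 2 := (norm_sq_eq_re_inner (𝕜 := ℂ) x).symm
  rw [h2] at this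
  refine this.congr_fun fun j => ?_
  rw [← inner_conj_symm, mul_comm (inner ℂ x (e j)), ← inner_conj_symm x,
    ← Complex.normSq_eq_conj_mul_self, Complex.ofReal_re, Complex.normSq_eq_norm_sq,
    inner_conj_symm, RCLike.norm_conj]

theorem HilbertBasis.summable_norm_inner_sq (e : HilbertBasis κ ℂ H) {x : ι → H}
    (hx : Summable fun i => ‖x i‖ ^ 2) :
    Summable fun p : ι × κ => ‖(inner ℂ (e p.2) (x p.1) : ℂ)‖ ^ 2 := by
  refine (summable_prod_of_nonneg fun p => sq_nonneg ‖(inner ℂ (e p.2) (x p.1) : ℂ)‖).2 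
    ⟨fun i => (e.hasSum_norm_inner_sq (x i)).summable, hx.congr fun i => ?_⟩
  exact (e.hasSum_norm_inner_sq (x i)).tsum_eq.symm

theorem HilbertBasis.summable_inner_mul_inner_prod (e : HilbertBasis κ ℂ H) {w v : ι → H}
    (hw : Summable fun i => ‖w i‖ ^ 2) (hv : Summable fun i => ‖v i‖ ^ 2) :
    Summable fun p : ι × κ => (inner ℂ (w p.1) (e p.2) * inner ℂ (e p.2) (v p.1) : ℂ) := by
  refine .of_norm_bounded ((e.summable_norm_inner_sq hv).add (e.summable_norm_inner_sq hw))
    fun p => ?_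
  rw [norm_mul, norm_inner_symm]
  have h := two_mul_le_add_sq ‖(inner ℂ (e p.2) (w p.1) : ℂ)‖ ‖(inner ℂ (e p.2) (v p.1) : ℂ)‖
  have h0 : 0 ≤ ‖(inner ℂ (e p.2) (w p.1) : ℂ)‖ * ‖(inner ℂ (e p.2) (v p.1) : ℂ)‖ := by
    positivity
  linarith

theorem IsEnsemble.hasSum_inner_mul_inner [CompleteSpace H] {v : ι → H} {ρ : H →L[ℂ] H}
    (hv : IsEnsemble v ρ) (T : H →L[ℂ] H) (x : H) :
    HasSum (fun i => (inner ℂ (ContinuousLinearMap.adjoint T (v i)) x * inner ℂ x (v i) : ℂ))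
      (inner ℂ x (ρ (T x))) := by
  refine ((hv.hasSum_apply (T x)).inner_right x).congr_fun fun i => ?_
  rw [inner_smul_right, ContinuousLinearMap.adjoint_inner_left]

theorem IsEnsemble.summable_adjoint [CompleteSpace H] {v : ι → H} {ρ : H →L[ℂ] H}
    (hv : IsEnsemble v ρ) (T : H →L[ℂ] H) :
    Summable fun i => ‖ContinuousLinearMap.adjoint T (v i)‖ ^ 2 := by
  refine .of_nonneg_of_le (fun _ => sq_nonneg _) (fun i => ?_)
    (hv.hasSum_norm_sq.summable.mul_left (‖ContinuousLinearMap.adjoint T‖ ^ 2))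
  rw [← mul_pow]
  gcongr
  exact ContinuousLinearMap.le_opNorm _ _

/-- Both sums are iterated sums of the absolutely convergent double series `⟪T* vᵢ, eⱼ⟫ ⟪eⱼ, vᵢ⟫`:
Parseval in `j` gives the first, the expansion of `ρ` in `i` the second. -/
theorem IsEnsemble.exists_hasSum_inner [CompleteSpace H] {v : ι → H} {ρ : H →L[ℂ] H}
    (hv : IsEnsemble v ρ) (T : H →L[ℂ] H) (e : HilbertBasis κ ℂ H) :
    ∃ c : ℂ, HasSum (fun i => (inner ℂ (v i) (T (v i)) : ℂ)) c ∧
      HasSum (fun j => (inner ℂ (e j) ((ρ * T) (e j)) : ℂ)) c := by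
  obtain ⟨c, hf⟩ := e.summable_inner_mul_inner_prod (hv.summable_adjoint T)
    hv.hasSum_norm_sq.summable
  have h1 : HasSum (fun i => (inner ℂ (ContinuousLinearMap.adjoint T (v i)) (v i) : ℂ)) c :=
    HasSum.prod_fiberwise hf fun i =>
      e.hasSum_inner_mul_inner (ContinuousLinearMap.adjoint T (v i)) (v i)
  refine ⟨c, ?_, HasSum.prod_fiberwise ((Equiv.prodComm κ ι).hasSum_iff.2 hf)
    fun j => hv.hasSum_inner_mul_inner T (e j)⟩
  simpa only [ContinuousLinearMap.adjoint_inner_left] using h1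

theorem IsEnsemble.hasSum_opTrace [CompleteSpace H] {v : ι → H} {ρ : H →L[ℂ] H}
    (hv : IsEnsemble v ρ) (T : H →L[ℂ] H) :
    HasSum (fun i => (inner ℂ (v i) (T (v i)) : ℂ)) (opTrace (ρ * T)) := by
  obtain ⟨c, h1, h2⟩ := hv.exists_hasSum_inner T (stdBasis H)
  rw [opTrace, h2.tsum_eq]
  exact h1

theorem IsEnsemble.isState [CompleteSpace H] {v : ι → H} {ρ : H →L[ℂ] H}
    (hv : IsEnsemble v ρ) : IsState ρ := by
  constructor
  · rw [← ContinuousLinearMap.nonneg_iff_isPositive]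
    exact hv.hasSum_rankOne.nonneg fun i => (ContinuousLinearMap.nonneg_iff_isPositive _).2
      (InnerProductSpace.isPositive_rankOne_self (v i))
  · obtain ⟨c, h1, h2⟩ := hv.exists_hasSum_inner 1 (stdBasis H)
    rw [mul_one] at h2
    have h3 : HasSum (fun i => (inner ℂ (v i) ((1 : H →L[ℂ] H) (v i)) : ℂ)) 1 := by
      have h4 := Complex.hasSum_ofReal.2 hv.hasSum_norm_sq
      rw [Complex.ofReal_one] at h4
      refine h4.congr_fun fun i => ?_
      rw [one_apply_eq_self, inner_self_eq_norm_sq_to_K]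
      norm_cast
    rwa [h1.unique h3] at h2

theorem IsEnsemble.hasSum_rejectProb [CompleteSpace H] {v : ι → H} {ρ : H →L[ℂ] H}
    (hv : IsEnsemble v ρ) (T : H →L[ℂ] H) :
    HasSum (fun i => (inner ℂ (v i) (T (v i)) : ℂ).re) (rejectProb ρ T) :=
  Complex.hasSum_re (hv.hasSum_opTrace T)

end Ensemble

/-! ### Tests and their rejection probabilities -/

section Tests

variable {H : Type*} [NormedAddCommGroup H] [InnerProductSpace ℂ H]

theorem isPositive_of_inner {A : H →L[ℂ] H}
    (hA : ∀ x, ∃ r : ℝ, inner ℂ x (A x) = (r : ℂ) ∧ 0 ≤ r) : A.IsPositive := by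
  rw [ContinuousLinearMap.isPositive_iff_complex]
  intro x
  obtain ⟨r, hr, h0⟩ := hA x
  have : (inner ℂ (A x) x : ℂ) = r := by rw [← inner_conj_symm, hr, Complex.conj_ofReal]
  rw [this]
  exact ⟨by simp, by simpa using h0⟩

/-- Partial traces and weak averages are known through their quadratic forms, so being a test is
phrased in those terms. -/
theorem isTest_iff {T : H →L[ℂ] H} :
    IsTest T ↔ ∀ x, ∃ r : ℝ, inner ℂ x (T x) = (r : ℂ) ∧ 0 ≤ r ∧ r ≤ ‖x‖ ^ 2 := by
  have hx : ∀ x : H, (inner ℂ x x : ℂ) = ((‖x‖ ^ 2 : ℝ) : ℂ) := fun x => by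
    rw [inner_self_eq_norm_sq_to_K]; norm_cast
  rw [IsTest, ContinuousLinearMap.nonneg_iff_isPositive, ContinuousLinearMap.le_def]
  constructor
  · rintro ⟨h0, h1⟩ x
    have h := Complex.nonneg_iff.1 (h0.inner_nonneg_right x)
    have h' := Complex.nonneg_iff.1 (h1.inner_nonneg_right x)
    refine ⟨(inner ℂ x (T x) : ℂ).re, Complex.ext rfl (by simpa using h.2.symm), h.1, ?_⟩
    have h2 : inner ℂ x ((1 - T) x) = ((‖x‖ ^ 2 : ℝ) : ℂ) - inner ℂ x (T x) := by
      rw [← hx, ← inner_sub_right]; rfl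
    rw [h2, Complex.sub_re, Complex.ofReal_re] at h'
    linarith [h'.1]
  · intro h
    refine ⟨isPositive_of_inner fun x => ?_, isPositive_of_inner fun x => ?_⟩
    · obtain ⟨r, hr, h0, -⟩ := h x
      exact ⟨r, hr, h0⟩
    · obtain ⟨r, hr, -, h1⟩ := h x
      refine ⟨‖x‖ ^ 2 - r, ?_, by linarith⟩
      rw [Complex.ofReal_sub, ← hr, ← hx, ← inner_sub_right]; rfl

theorem IsTest.re_inner_nonneg {T : H →L[ℂ] H} (hT : IsTest T) (x : H) :
    0 ≤ (inner ℂ x (T x) : ℂ).re := by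
  obtain ⟨r, hr, h0, -⟩ := isTest_iff.1 hT x
  simpa [hr] using h0

theorem IsTest.re_inner_le {T : H →L[ℂ] H} (hT : IsTest T) (x : H) :
    (inner ℂ x (T x) : ℂ).re ≤ ‖x‖ ^ 2 := by
  obtain ⟨r, hr, -, h1⟩ := isTest_iff.1 hT x
  simpa [hr] using h1

theorem IsTest.inner_eq_re {T : H →L[ℂ] H} (hT : IsTest T) (x : H) :
    inner ℂ x (T x) = ((inner ℂ x (T x) : ℂ).re : ℂ) := by
  obtain ⟨r, hr, -, -⟩ := isTest_iff.1 hT x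
  simp [hr]

theorem IsTest.conj {E : Type*} [NormedAddCommGroup E] [InnerProductSpace ℂ E] [CompleteSpace E]
    {T : H →L[ℂ] H} (hT : IsTest T) {J : E →L[ℂ] H} (hJ : ∀ x, ‖J x‖ ≤ ‖x‖) {S : E →L[ℂ] E}
    (hS : ∀ x, inner ℂ x (S x) = inner ℂ (J x) (T (J x))) : IsTest S := by
  refine isTest_iff.2 fun x => ⟨_, (hS x).trans (hT.inner_eq_re _), hT.re_inner_nonneg _, ?_⟩
  exact (hT.re_inner_le _).trans (by gcongr; exact hJ x)

variable [CompleteSpace H]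

theorem isTest_unitaryConj {T : H →L[ℂ] H} (U : unitary (H →L[ℂ] H)) :
    IsTest (unitaryConj U T) ↔ IsTest T := by
  have key : ∀ (U : unitary (H →L[ℂ] H)) (T : H →L[ℂ] H), IsTest T → IsTest (unitaryConj U T) :=
    fun U T hT => hT.conj (J := (U : H →L[ℂ] H))
      (fun x => (ContinuousLinearMap.norm_map_of_mem_unitary U.2 x).le) fun x => by
        simp [unitaryConj, ContinuousLinearMap.star_eq_adjoint,
          ContinuousLinearMap.adjoint_inner_right]
  refine ⟨fun h => ?_, key U T⟩
  convert key (star U) _ h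
  have h1 : (U : H →L[ℂ] H) * star (U : H →L[ℂ] H) = 1 := Unitary.mul_star_self_of_mem U.2
  simp only [unitaryConj, Unitary.coe_star, star_star]
  rw [mul_assoc, mul_assoc, mul_assoc, h1, mul_one, ← mul_assoc, h1, one_mul]

theorem rejectProb_unitaryConj {ρ : H →L[ℂ] H} (U : unitary (H →L[ℂ] H))
    {ι : Type*} {v : ι → H} (hv : IsEnsemble v ρ) (T : H →L[ℂ] H) :
    rejectProb (unitaryConj U ρ) (unitaryConj U T) = rejectProb ρ T := by
  have h1 : (U : H →L[ℂ] H) * star (U : H →L[ℂ] H) = 1 := Unitary.mul_star_self_of_mem U.2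
  have h2 : ∀ x, (U : H →L[ℂ] H) (star (U : H →L[ℂ] H) x) = x := fun x => by
    rw [← mul_apply_eq_comp, h1]; rfl
  have hU := (hv.conj (Unitary.star_mem U.2)).hasSum_rejectProb (unitaryConj U T)
  rw [star_star] at hU
  refine hU.unique ((hv.hasSum_rejectProb T).congr_fun fun i => ?_)
  simp only [unitaryConj, mul_apply_eq_comp, h2]
  rw [ContinuousLinearMap.inner_map_map_of_mem_unitary (Unitary.star_mem U.2)]

end Tests

/-! ### Partial matrix elements -/

section Slice

variable {E F : Type*} [NormedAddCommGroup E] [InnerProductSpace ℂ E]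
  [NormedAddCommGroup F] [InnerProductSpace ℂ F]

/-- The operator on the first factor with matrix elements `⟪x ⊗ y, T (x' ⊗ y')⟫`. -/
noncomputable def sliceRight [CompleteSpace E]
    (T : HilbertTensor E F →L[ℂ] HilbertTensor E F) (y y' : F) : E →L[ℂ] E :=
  (ContinuousLinearMap.adjoint ((hilbertTmul (E := E)).flip y)).comp
    (T.comp ((hilbertTmul (E := E)).flip y'))

/-- The operator on the second factor with matrix elements `⟪x ⊗ y, T (x' ⊗ y')⟫`. -/
noncomputable def sliceLeft [CompleteSpace F]
    (T : HilbertTensor E F →L[ℂ] HilbertTensor E F) (x x' : E) : F →L[ℂ] F :=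
  (ContinuousLinearMap.adjoint (hilbertTmul (F := F) x)).comp (T.comp (hilbertTmul (F := F) x'))

theorem inner_sliceRight [CompleteSpace E]
    (T : HilbertTensor E F →L[ℂ] HilbertTensor E F) (y y' : F) (x x' : E) :
    inner ℂ x (sliceRight T y y' x') = inner ℂ (hilbertTmul x y) (T (hilbertTmul x' y')) := by
  rw [sliceRight, ContinuousLinearMap.comp_apply, ContinuousLinearMap.adjoint_inner_right]
  rfl

theorem inner_sliceLeft [CompleteSpace F]
    (T : HilbertTensor E F →L[ℂ] HilbertTensor E F) (y y' : F) (x x' : E) :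
    inner ℂ y (sliceLeft T x x' y') = inner ℂ (hilbertTmul x y) (T (hilbertTmul x' y')) := by
  rw [sliceLeft, ContinuousLinearMap.comp_apply, ContinuousLinearMap.adjoint_inner_right]
  rfl

theorem norm_sliceRight_le [CompleteSpace E]
    (T : HilbertTensor E F →L[ℂ] HilbertTensor E F) (y y' : F) :
    ‖sliceRight T y y'‖ ≤ ‖T‖ * ‖y‖ * ‖y'‖ := by
  have h : ∀ y : F, ‖(hilbertTmul (E := E)).flip y‖ ≤ ‖y‖ := fun y =>
    ContinuousLinearMap.opNorm_le_bound _ (norm_nonneg _) fun x => by simp [mul_comm]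
  calc ‖sliceRight T y y'‖
      ≤ ‖y‖ * (‖T‖ * ‖y'‖) := by
        refine (ContinuousLinearMap.opNorm_comp_le _ _).trans ?_
        rw [LinearIsometryEquiv.norm_map]
        exact mul_le_mul (h y) ((ContinuousLinearMap.opNorm_comp_le _ _).trans
          (by gcongr; exact h y')) (norm_nonneg _) (norm_nonneg _)
    _ = ‖T‖ * ‖y‖ * ‖y'‖ := by ring

variable [CompleteSpace E] [CompleteSpace F]

/-- Fixing the state of the second system turns a test into a test on the first system. -/
theorem exists_partial_test {T : HilbertTensor E F →L[ℂ] HilbertTensor E F} (hT : IsTest T)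
    {σ : F →L[ℂ] F} (hσ : IsState σ) :
    ∃ S : E →L[ℂ] E, IsTest S ∧
      ∀ ρ, IsState ρ → rejectProb ρ S = rejectProb (opTensor ρ σ) T := by
  obtain ⟨w, hw⟩ := hσ.exists_isEnsemble
  -- The sum of these slices is the partial trace of `(1 ⊗ σ) T` over the second factor.
  have hs : Summable fun j => sliceRight T (w j) (w j) := by
    refine .of_norm_bounded (hw.hasSum_norm_sq.summable.mul_left ‖T‖) fun j => ?_
    exact (norm_sliceRight_le T _ _).trans_eq (by ring)
  have hS : ∀ x, HasSum (fun j => inner ℂ (hilbertTmul x (w j)) (T (hilbertTmul x (w j))))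
      (inner ℂ x ((∑' j, sliceRight T (w j) (w j)) x)) := fun x => by
    simp only [← inner_sliceRight]
    exact (hs.hasSum.mapL (ContinuousLinearMap.apply ℂ E x)).inner_right x
  have hre : ∀ x, HasSum (fun j => (inner ℂ (hilbertTmul x (w j))
      (T (hilbertTmul x (w j))) : ℂ).re) (inner ℂ x ((∑' j, sliceRight T (w j) (w j)) x) : ℂ).re :=
    fun x => Complex.hasSum_re (hS x)
  refine ⟨∑' j, sliceRight T (w j) (w j), isTest_iff.2 fun x => ⟨_, ?_, (hre x).nonneg
    fun j => hT.re_inner_nonneg _, ?_⟩, fun ρ hρ => ?_⟩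
  · refine (hS x).unique ((Complex.hasSum_ofReal.2 (hre x)).congr_fun fun j => ?_)
    exact hT.inner_eq_re _
  · have h2 := hw.hasSum_norm_sq.mul_left (‖x‖ ^ 2)
    rw [mul_one] at h2
    refine hasSum_le (fun j => (hT.re_inner_le _).trans_eq ?_) (hre x) h2
    rw [norm_hilbertTmul, mul_pow]
  · obtain ⟨v, hv⟩ := hρ.exists_isEnsemble
    exact (hv.hasSum_rejectProb _).unique
      (((hv.tmul hw).hasSum_rejectProb T).prod_fiberwise fun i => hre (v i))

/-- Compression along `x ↦ x ⊗ y` with a unit vector `y` recovers `T` from `T ⊗ 1`. Conversely `A ⊗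
1` is the square of the self-adjoint `√A ⊗ 1`, used for `A = T` and `A = 1 - T`. -/
theorem isTest_opTensor_one [Nontrivial F] {T : E →L[ℂ] E} :
    IsTest (opTensor T (1 : F →L[ℂ] F)) ↔ IsTest T := by
  constructor
  · intro h
    obtain ⟨y, hy⟩ := exists_norm_eq F zero_le_one
    refine h.conj (J := (hilbertTmul (E := E)).flip y) (fun x => by simp [hy]) fun x => ?_
    simp [inner_self_eq_norm_sq_to_K, hy]
  · have key : ∀ A : E →L[ℂ] E, 0 ≤ A → 0 ≤ opTensor A (1 : F →L[ℂ] F) := fun A hA => by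
      have h : star (opTensor (CFC.sqrt A) (1 : F →L[ℂ] F)) * opTensor (CFC.sqrt A) 1 =
          opTensor A 1 := by
        rw [star_opTensor, opTensor_mul, (CFC.sqrt_nonneg A).isSelfAdjoint.star_eq,
          CFC.sqrt_mul_sqrt_self A hA, star_one, one_mul]
      rw [← h]
      exact star_mul_self_nonneg (opTensor (CFC.sqrt A) (1 : F →L[ℂ] F))
    rintro ⟨h0, h1⟩
    refine ⟨key T h0, ?_⟩
    have h := key (1 - T) (sub_nonneg.2 h1)
    have h2 : opTensor (1 - T) (1 : F →L[ℂ] F) + opTensor T 1 = 1 := by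
      rw [← opTensor_add_left, sub_add_cancel, opTensor_one]
    rw [← h2]
    exact le_add_of_nonneg_left h

theorem rejectProb_opTensor_one {ι κ : Type*} {v : ι → E} {w : κ → F} {ρ : E →L[ℂ] E}
    {σ : F →L[ℂ] F} (hv : IsEnsemble v ρ) (hw : IsEnsemble w σ) (T : E →L[ℂ] E) :
    rejectProb (opTensor ρ σ) (opTensor T 1) = rejectProb ρ T := by
  refine (((hv.tmul hw).hasSum_rejectProb (opTensor T 1)).prod_fiberwise fun i => ?_).unique
    (hv.hasSum_rejectProb T)
  have h := hw.hasSum_norm_sq.mul_left (inner ℂ (v i) (T (v i)) : ℂ).re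
  rw [mul_one] at h
  refine h.congr_fun fun j => ?_
  rw [opTensor_hilbertTmul, inner_hilbertTmul, one_apply_eq_self,
    inner_self_eq_norm_sq_to_K]
  norm_cast
  exact Complex.re_mul_ofReal _ _

end Slice

/-! ### Invariant means and averages of operators -/

section Mean

/-- A continuous left invariant mean on the bounded continuous real functions of `G`. -/
structure IsInvariantMean {G : Type*} [Group G] [TopologicalSpace G] [ContinuousMul G]
    (m : (G →ᵇ ℝ) →L[ℝ] ℝ) : Prop where
  nonneg : ∀ f : G →ᵇ ℝ, (∀ x, 0 ≤ f x) → 0 ≤ m f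
  map_one : m (BoundedContinuousFunction.const G 1) = 1
  map_mulLeft : ∀ (g : G) (f : G →ᵇ ℝ), m (f.compContinuous (ContinuousMap.mulLeft g)) = m f

variable {G : Type*} [TopologicalSpace G]

theorem le_map_of_nonneg_of_map_one {m : (G →ᵇ ℝ) →ₗ[ℝ] ℝ}
    (h0 : ∀ f : G →ᵇ ℝ, (∀ x, 0 ≤ f x) → 0 ≤ m f)
    (h1 : m (BoundedContinuousFunction.const G 1) = 1) {f : G →ᵇ ℝ} {a : ℝ} (h : ∀ x, a ≤ f x) :
    a ≤ m f := by
  have := h0 (f - a • BoundedContinuousFunction.const G 1) fun x => by simpa using h x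
  rw [map_sub, map_smul, h1, smul_eq_mul, mul_one] at this
  linarith

theorem map_le_of_nonneg_of_map_one {m : (G →ᵇ ℝ) →ₗ[ℝ] ℝ}
    (h0 : ∀ f : G →ᵇ ℝ, (∀ x, 0 ≤ f x) → 0 ≤ m f)
    (h1 : m (BoundedContinuousFunction.const G 1) = 1) {f : G →ᵇ ℝ} {a : ℝ} (h : ∀ x, f x ≤ a) :
    m f ≤ a := by
  have := le_map_of_nonneg_of_map_one h0 h1 (f := -f) (a := -a) fun x => neg_le_neg (h x)
  rw [map_neg] at this
  linarith

variable [Group G] [ContinuousMul G]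

/-- Positivity and normalization force norm at most one; the resulting continuity is what lets the
mean pass through norm convergent sums. -/
theorem IsAmenable.exists_isInvariantMean (hG : IsAmenable G) :
    ∃ m : (G →ᵇ ℝ) →L[ℝ] ℝ, IsInvariantMean m := by
  obtain ⟨m, h0, h1, h2⟩ := hG
  refine ⟨m.mkContinuous 1 fun f => ?_, h0, h1, h2⟩
  rw [one_mul, Real.norm_eq_abs, abs_le]
  exact ⟨le_map_of_nonneg_of_map_one h0 h1 fun x => neg_le_of_abs_le (f.norm_coe_le_norm x),
    map_le_of_nonneg_of_map_one h0 h1 fun x => le_of_abs_le (f.norm_coe_le_norm x)⟩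

theorem IsInvariantMean.le_map {m : (G →ᵇ ℝ) →L[ℝ] ℝ} (hm : IsInvariantMean m) {f : G →ᵇ ℝ}
    {a : ℝ} (h : ∀ x, a ≤ f x) : a ≤ m f :=
  le_map_of_nonneg_of_map_one (m := m.toLinearMap) hm.nonneg hm.map_one h

theorem IsInvariantMean.map_le {m : (G →ᵇ ℝ) →L[ℝ] ℝ} (hm : IsInvariantMean m) {f : G →ᵇ ℝ}
    {a : ℝ} (h : ∀ x, f x ≤ a) : m f ≤ a :=
  map_le_of_nonneg_of_map_one (m := m.toLinearMap) hm.nonneg hm.map_one h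

end Mean

section Average

variable {X H : Type*} [TopologicalSpace X] [NormedAddCommGroup H] [InnerProductSpace ℂ H]

/-- The bounded continuous function `g ↦ ⟪x, W g y⟫` of a bounded weakly continuous family of
operators. -/
noncomputable def matrixElement (W : X → H →L[ℂ] H) (C : ℝ) (hC : ∀ g, ‖W g‖ ≤ C)
    (hW : ∀ x y, Continuous fun g => (inner ℂ x (W g y) : ℂ)) (x y : H) : X →ᵇ ℂ :=
  .ofNormedAddCommGroup (fun g => inner ℂ x (W g y)) (hW x y) (C * ‖x‖ * ‖y‖) fun g => by
    calc ‖(inner ℂ x (W g y) : ℂ)‖ ≤ ‖x‖ * ‖W g y‖ := norm_inner_le_norm _ _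
      _ ≤ ‖x‖ * (C * ‖y‖) := by
        gcongr
        exact (W g).le_of_opNorm_le (hC g) y
      _ = C * ‖x‖ * ‖y‖ := by ring

/-- The weak average of a bounded weakly continuous family of operators. -/
theorem exists_average [CompleteSpace H] (m : (X →ᵇ ℝ) →L[ℝ] ℝ) {W : X → H →L[ℂ] H} {C : ℝ}
    (hC0 : 0 ≤ C) (hC : ∀ g, ‖W g‖ ≤ C)
    (hW : ∀ x y, Continuous fun g => (inner ℂ x (W g y) : ℂ)) :
    ∃ B : H →L[ℂ] H, ∀ x (f : X →ᵇ ℝ), (∀ g, (inner ℂ x (W g x) : ℂ) = f g) →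
      (inner ℂ x (B x) : ℂ) = m f := by
  let reL : (X →ᵇ ℂ) →L[ℝ] (X →ᵇ ℝ) := Complex.reCLM.compLeftContinuousBounded X
  -- The mean is extended complex linearly, so that `(x, y) ↦ M (⟪x, W · y⟫)` is a bounded
  -- sesquilinear form and hence is represented by an operator.
  let M : (X →ᵇ ℂ) →L[ℂ] ℂ := StrongDual.extendRCLike (m.comp reL)
  have hM : ∀ F : X →ᵇ ℂ, M F = m (reL F) - Complex.I * m (reL (Complex.I • F)) := fun F => rfl
  let φ := matrixElement W C hC hW
  have hφ : ∀ x y, ‖φ x y‖ ≤ C * ‖x‖ * ‖y‖ := fun x y =>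
    BoundedContinuousFunction.norm_ofNormedAddCommGroup_le _ (by positivity) _
  let b : H →L⋆[ℂ] H →L[ℂ] ℂ := LinearMap.mkContinuous₂
    (LinearMap.mk₂'ₛₗ (starRingEnd ℂ) (RingHom.id ℂ) (fun x y => M (φ x y))
      (fun x x' y => by
        rw [← map_add]; congr 1; ext g; exact inner_add_left _ _ _)
      (fun c x y => by
        rw [smul_eq_mul, ← smul_eq_mul, ← map_smul]; congr 1; ext g
        exact inner_smul_left _ _ _)
      (fun x y y' => by
        rw [← map_add]; congr 1; ext g
        exact (congrArg _ (map_add _ _ _)).trans (inner_add_right _ _ _))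
      (fun c x y => by
        rw [RingHom.id_apply, ← map_smul]; congr 1; ext g
        exact (congrArg _ (map_smul _ _ _)).trans (inner_smul_right _ _ _)))
    (‖M‖ * C) fun x y => by
      calc ‖M (φ x y)‖ ≤ ‖M‖ * ‖φ x y‖ := M.le_opNorm _
        _ ≤ ‖M‖ * (C * ‖x‖ * ‖y‖) := by gcongr; exact hφ x y
        _ = ‖M‖ * C * ‖x‖ * ‖y‖ := by ring
  refine ⟨ContinuousLinearMap.adjoint (InnerProductSpace.continuousLinearMapOfBilin b),
    fun x f hf => ?_⟩
  rw [ContinuousLinearMap.adjoint_inner_right,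
    InnerProductSpace.continuousLinearMapOfBilin_apply]
  change M (φ x x) = m f
  have h1 : reL (φ x x) = f := by
    ext g
    change (inner ℂ x (W g x) : ℂ).re = f g
    rw [hf, Complex.ofReal_re]
  have h2 : reL (Complex.I • φ x x) = 0 := by
    ext g
    change (Complex.I * (inner ℂ x (W g x) : ℂ)).re = 0
    rw [hf]
    simp
  rw [hM, h1, h2]
  simp

end Average

/-! ### Irreducible projective representations -/

section Representation

variable {G : Type*} [Group G]
variable {H : Type*} [NormedAddCommGroup H] [InnerProductSpace ℂ H] [CompleteSpace H]

theorem exists_phase_norm_sub_sq {u v : H} (h : ‖u‖ = ‖v‖) :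
    ∃ c : ℂ, ‖c‖ = 1 ∧ ‖c • u - v‖ ^ 2 = 2 * (‖v‖ ^ 2 - ‖(inner ℂ v u : ℂ)‖) := by
  obtain ⟨c, hc, hc'⟩ := RCLike.exists_norm_eq_mul_self (inner ℂ v u : ℂ)
  refine ⟨c, hc, ?_⟩
  have h1 := norm_sub_sq (𝕜 := ℂ) (c • u) v
  rw [h1, norm_smul, hc, one_mul, h, ← inner_conj_symm, RCLike.conj_re, inner_smul_right, ← hc',
    RCLike.ofReal_re]
  ring

/-- Quadratic forms ignore phases, so `u` may be rotated until `⟪v, u⟫ ≥ 0`. The bound involves only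
`|⟪v, u⟫|`, the quantity whose continuity a projective representation provides. -/
theorem norm_inner_sub_inner_le (A : H →L[ℂ] H) {u v : H} (h : ‖u‖ = ‖v‖) :
    ‖(inner ℂ u (A u) - inner ℂ v (A v) : ℂ)‖ ≤
      2 * ‖A‖ * ‖v‖ * √(2 * (‖v‖ ^ 2 - ‖(inner ℂ v u : ℂ)‖)) := by
  obtain ⟨c, hc, hcu⟩ := exists_phase_norm_sub_sq h
  rw [← hcu, Real.sqrt_sq (norm_nonneg _)]
  have hcc : (starRingEnd ℂ) c * c = 1 := by
    rw [← Complex.normSq_eq_conj_mul_self, Complex.normSq_eq_norm_sq, hc]; simp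
  have h1 : (inner ℂ u (A u) : ℂ) = inner ℂ (c • u) (A (c • u)) := by
    rw [map_smul, inner_smul_left, inner_smul_right, ← mul_assoc, hcc, one_mul]
  have h2 : (inner ℂ u (A u) - inner ℂ v (A v) : ℂ) =
      inner ℂ (c • u - v) (A (c • u)) + inner ℂ v (A (c • u - v)) := by
    rw [h1, inner_sub_left, map_sub, inner_sub_right]; ring
  have hn : ‖c • u‖ = ‖v‖ := by rw [norm_smul, hc, one_mul, h]
  calc ‖(inner ℂ u (A u) - inner ℂ v (A v) : ℂ)‖
      ≤ ‖c • u - v‖ * ‖A (c • u)‖ + ‖v‖ * ‖A (c • u - v)‖ := by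
        rw [h2]
        exact (norm_add_le _ _).trans (add_le_add (norm_inner_le_norm _ _)
          (norm_inner_le_norm _ _))
    _ ≤ ‖c • u - v‖ * (‖A‖ * ‖v‖) + ‖v‖ * (‖A‖ * ‖c • u - v‖) := by
        gcongr
        · rw [← hn]; exact A.le_opNorm _
        · exact A.le_opNorm _
    _ = 2 * ‖A‖ * ‖v‖ * ‖c • u - v‖ := by ring

theorem IsProjectiveUnitaryRep.norm_map [TopologicalSpace G] {V : G → H →L[ℂ] H}
    (hV : IsProjectiveUnitaryRep V) (g : G) (x : H) : ‖V g x‖ = ‖x‖ :=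
  ContinuousLinearMap.norm_map_of_mem_unitary (hV.unitary_mem g) x

theorem IsProjectiveUnitaryRep.continuous_inner [TopologicalSpace G] {V : G → H →L[ℂ] H}
    (hV : IsProjectiveUnitaryRep V) (A : H →L[ℂ] H) (x : H) :
    Continuous fun g => (inner ℂ (V g x) (A (V g x)) : ℂ) := by
  rw [continuous_iff_continuousAt]
  intro g₀
  rw [ContinuousAt, tendsto_iff_norm_sub_tendsto_zero]
  refine squeeze_zero (fun _ => norm_nonneg _) (fun g => norm_inner_sub_inner_le A
    ((hV.norm_map g x).trans (hV.norm_map g₀ x).symm)) ?_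
  have hc : Continuous fun g => 2 * ‖A‖ * ‖V g₀ x‖ *
      √(2 * (‖V g₀ x‖ ^ 2 - ‖(inner ℂ (V g₀ x) (V g x) : ℂ)‖)) := by
    have := hV.continuous_norm_inner (V g₀ x) x
    fun_prop
  convert hc.tendsto g₀ using 2
  rw [inner_self_eq_norm_sq_to_K]
  simp

theorem IsProjectiveUnitaryRep.inner_map_mul [TopologicalSpace G] {V : G → H →L[ℂ] H}
    (hV : IsProjectiveUnitaryRep V) (A : H →L[ℂ] H) (g h : G) (x : H) :
    (inner ℂ (V (g * h) x) (A (V (g * h) x)) : ℂ) = inner ℂ (V g (V h x)) (A (V g (V h x))) := by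
  obtain ⟨c, hc, hgh⟩ := hV.map_mul g h
  have hcc : (starRingEnd ℂ) c * c = 1 := by
    rw [← Complex.normSq_eq_conj_mul_self, Complex.normSq_eq_norm_sq, hc]; simp
  rw [hgh, smul_apply, mul_apply_eq_comp, map_smul, inner_smul_left,
    inner_smul_right, ← mul_assoc, hcc, one_mul]

/-- A weak form of Schur's lemma. -/
theorem IsIrreducibleRep.inner_self_eq {V : G → H →L[ℂ] H} (hV : IsIrreducibleRep V)
    {B : H →L[ℂ] H} (hB : IsSelfAdjoint B) (hBV : ∀ g, Commute B (V g)) {x y : H}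
    (hxy : ‖x‖ = ‖y‖) : (inner ℂ x (B x) : ℂ).re = (inner ℂ y (B y) : ℂ).re := by
  have key : ∀ x y : H, ‖x‖ = ‖y‖ →
      ¬ (inner ℂ x (B x) : ℂ).re < (inner ℂ y (B y) : ℂ).re := fun x y hxy hlt => by
    have hy : 0 < ‖y‖ ^ 2 := by
      refine (sq_nonneg _).lt_of_ne fun h => hlt.ne ?_
      have hy0 : y = 0 := by simpa using h.symm
      have hx0 : x = 0 := by simpa [hy0] using hxy
      rw [hx0, hy0]
    -- This midpoint makes the quadratic form of `D = B - c` negative at `x` and positive at `y`.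
    set c : ℝ := ((inner ℂ x (B x) : ℂ).re + (inner ℂ y (B y) : ℂ).re) / (2 * ‖y‖ ^ 2) with hc
    have hc' : c * ‖y‖ ^ 2 = ((inner ℂ x (B x) : ℂ).re + (inner ℂ y (B y) : ℂ).re) / 2 := by
      rw [hc, div_mul_eq_mul_div, div_eq_div_iff (by positivity) two_ne_zero]; ring
    let D : H →L[ℂ] H := B - (c : ℂ) • 1
    have hD : IsSelfAdjoint D :=
      hB.sub (IsSelfAdjoint.smul (by rw [isSelfAdjoint_iff]; exact Complex.conj_ofReal c)
        (IsSelfAdjoint.one _))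
    have hDin : ∀ z, (inner ℂ z (D z) : ℂ).re = (inner ℂ z (B z) : ℂ).re - c * ‖z‖ ^ 2 :=
      fun z => by
        have h : D z = B z - (c : ℂ) • z := rfl
        rw [h, inner_sub_right, inner_smul_right, Complex.sub_re, Complex.re_ofReal_mul]
        congr 2
        exact (norm_sq_eq_re_inner (𝕜 := ℂ) z).symm
    have hpos : ∀ (A : H →L[ℂ] H) (z : H), 0 ≤ A → 0 ≤ (inner ℂ z (A z) : ℂ).re :=
      fun A z hA => (Complex.nonneg_iff.1
        (((ContinuousLinearMap.nonneg_iff_isPositive A).1 hA).inner_nonneg_right z)).1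
    have hdec := CFC.posPart_sub_negPart D hD
    have hcomm : ∀ g, Commute D⁺ (V g) := fun g =>
      Commute.cfcₙ_real ((hBV g).sub_left ((Commute.one_left _).smul_left _)) _
    -- The kernel of `D⁺` is invariant. If it is zero, `D⁺ D⁻ = 0` gives `D⁻ = 0` and `D ≥ 0`,
    -- contradicting the sign at `x`; if it is everything, `D ≤ 0`, contradicting the sign at `y`.
    rcases hV.2 (LinearMap.ker D⁺.toLinearMap) D⁺.isClosed_ker (fun g z hz => by
      have hz' : D⁺ z = 0 := hz
      change (D⁺ * V g) z = 0
      rw [(hcomm g).eq, mul_apply_eq_comp, hz', map_zero]) with hker | hker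
    · have hneg : D⁻ = 0 := by
        ext z
        have h : D⁻ z ∈ LinearMap.ker D⁺.toLinearMap := by
          change (D⁺ * D⁻) z = 0
          rw [CFC.posPart_mul_negPart]; rfl
        rw [hker] at h
        simpa using h
      rw [hneg, sub_zero] at hdec
      have h := hpos D x (hdec ▸ CFC.posPart_nonneg D)
      rw [hDin, hxy, hc'] at h
      linarith
    · have hzero : D⁺ = 0 := by
        ext z
        have h : z ∈ LinearMap.ker D⁺.toLinearMap := hker ▸ Submodule.mem_top
        exact h
      rw [hzero, zero_sub] at hdec
      have h := hpos (-D) y (by rw [← hdec, neg_neg]; exact CFC.negPart_nonneg D)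
      rw [neg_apply, inner_neg_right, Complex.neg_re, hDin, hc'] at h
      linarith
  exact le_antisymm (not_lt.1 (key y x hxy.symm)) (not_lt.1 (key x y hxy))

theorem commute_of_inner_map_eq {B U : H →L[ℂ] H} (hU : U ∈ unitary (H →L[ℂ] H))
    (h : ∀ x, (inner ℂ (U x) (B (U x)) : ℂ) = inner ℂ x (B x)) : Commute B U := by
  have h1 : star U * B * U = B := by
    refine ContinuousLinearMap.coe_inj.1 ((ext_inner_map _ _).1 fun x => ?_)
    rw [← inner_conj_symm, ← inner_conj_symm _ x]
    congr 1
    exact (ContinuousLinearMap.adjoint_inner_right U x (B (U x))).trans (h x)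
  have h2 : U * star U = 1 := Unitary.mul_star_self_of_mem hU
  calc B * U = U * star U * (B * U) := by rw [h2, one_mul]
    _ = U * (star U * B * U) := by simp only [mul_assoc]
    _ = U * B := by rw [h1]

end Representation

/-! ### Averaging a test over an amenable group -/

section HuntStein

variable {G : Type*} [Group G] [TopologicalSpace G] [IsTopologicalGroup G]
variable {E F : Type*} [NormedAddCommGroup E] [InnerProductSpace ℂ E]
  [NormedAddCommGroup F] [InnerProductSpace ℂ F] [CompleteSpace F]

theorem continuous_inner_of_diag {X H : Type*} [TopologicalSpace X] [NormedAddCommGroup H]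
    [InnerProductSpace ℂ H] {W : X → H →L[ℂ] H}
    (hW : ∀ x, Continuous fun g => (inner ℂ x (W g x) : ℂ)) (x y : H) :
    Continuous fun g => (inner ℂ x (W g y) : ℂ) := by
  have h : ∀ x, Continuous fun g => (inner ℂ (W g x) x : ℂ) := fun x => by
    refine (Complex.continuous_conj.comp (hW x)).congr fun g => ?_
    exact inner_conj_symm _ _
  have h2 : Continuous fun g => (inner ℂ (W g y) x : ℂ) := by
    have h3 : ∀ g, (inner ℂ (W g y) x : ℂ) = _ := fun g =>
      inner_map_polarization (W g).toLinearMap x y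
    refine Continuous.congr ?_ fun g => (h3 g).symm
    exact ((((h _).sub (h _)).add (continuous_const.mul (h _))).sub
      (continuous_const.mul (h _))).div_const _
  refine (Complex.continuous_conj.comp h2).congr fun g => ?_
  exact inner_conj_symm _ _

/-- The rejection functional of the test `T` along the orbit of the vector `x` of the second
system, the first system being in the (unnormalized) vector state `k`. -/
noncomputable def orbitFun {V : G → F →L[ℂ] F} (hV : IsProjectiveUnitaryRep V)
    {T : HilbertTensor E F →L[ℂ] HilbertTensor E F} (hT : IsTest T) (k : E) (x : F) : G →ᵇ ℝ :=
  .ofNormedAddCommGroup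
    (fun g => (inner ℂ (hilbertTmul k (V g⁻¹ x)) (T (hilbertTmul k (V g⁻¹ x))) : ℂ).re)
    (by
      simp only [← inner_sliceLeft]
      exact Complex.continuous_re.comp
        ((hV.continuous_inner (sliceLeft T k k) x).comp continuous_inv))
    (‖k‖ ^ 2 * ‖x‖ ^ 2) fun g => by
      rw [Real.norm_of_nonneg (hT.re_inner_nonneg _)]
      refine (hT.re_inner_le _).trans_eq ?_
      rw [norm_hilbertTmul, hV.norm_map, mul_pow]

variable {V : G → F →L[ℂ] F} (hV : IsProjectiveUnitaryRep V)
  {T : HilbertTensor E F →L[ℂ] HilbertTensor E F} (hT : IsTest T)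

theorem orbitFun_apply (k : E) (x : F) (g : G) : orbitFun hV hT k x g =
    (inner ℂ (hilbertTmul k (V g⁻¹ x)) (T (hilbertTmul k (V g⁻¹ x))) : ℂ).re := rfl

theorem coe_orbitFun_apply (k : E) (x : F) (g : G) :
    inner ℂ (hilbertTmul k (V g⁻¹ x)) (T (hilbertTmul k (V g⁻¹ x))) =
      (orbitFun hV hT k x g : ℂ) := hT.inner_eq_re _

theorem orbitFun_nonneg (k : E) (x : F) (g : G) : 0 ≤ orbitFun hV hT k x g :=
  hT.re_inner_nonneg _

theorem orbitFun_le (k : E) (x : F) (g : G) : orbitFun hV hT k x g ≤ ‖k‖ ^ 2 * ‖x‖ ^ 2 := by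
  refine (hT.re_inner_le _).trans_eq ?_
  rw [norm_hilbertTmul, hV.norm_map, mul_pow]

theorem norm_orbitFun_le (k : E) (x : F) : ‖orbitFun hV hT k x‖ ≤ ‖k‖ ^ 2 * ‖x‖ ^ 2 :=
  BoundedContinuousFunction.norm_ofNormedAddCommGroup_le _ (by positivity) _

/-- The inverse in `orbitFun` serves this purpose: up to a phase `V g⁻¹ V h = V (h⁻¹ g)⁻¹`, so
moving the vector is a left translation, under which the mean is invariant. -/
theorem orbitFun_map (k : E) (x : F) (h : G) : orbitFun hV hT k (V h x) =
    (orbitFun hV hT k x).compContinuous (ContinuousMap.mulLeft h⁻¹) := by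
  ext g
  change orbitFun hV hT k (V h x) g = orbitFun hV hT k x (h⁻¹ * g)
  simp only [orbitFun_apply, ← inner_sliceLeft, mul_inv_rev, inv_inv, hV.inner_map_mul]

variable {m : (G →ᵇ ℝ) →L[ℝ] ℝ} (hm : IsInvariantMean m)

include hm in
/-- The mean rejection probability along an orbit does not depend on the vector, by
irreducibility. -/
theorem IsInvariantMean.map_orbitFun (hirr : IsIrreducibleRep V) (k : E) {x x₀ : F}
    (hx₀ : ‖x₀‖ = 1) :
    m (orbitFun hV hT k x) = ‖x‖ ^ 2 * m (orbitFun hV hT k x₀) := by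
  have hV1 : ∀ g, ‖V g‖ ≤ 1 := fun g => ContinuousLinearMap.opNorm_le_bound _ zero_le_one
    fun y => by rw [hV.norm_map, one_mul]
  let W : G → F →L[ℂ] F := fun g => star (V g⁻¹) * sliceLeft T k k * V g⁻¹
  have hWin : ∀ y g, inner ℂ y (W g y) = (orbitFun hV hT k y g : ℂ) := fun y g => by
    rw [← coe_orbitFun_apply, ← inner_sliceLeft]
    exact ContinuousLinearMap.adjoint_inner_right (V g⁻¹) _ _
  have hWn : ∀ g, ‖W g‖ ≤ ‖sliceLeft T k k‖ := fun g => by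
    calc ‖W g‖ ≤ ‖star (V g⁻¹)‖ * ‖sliceLeft T k k‖ * ‖V g⁻¹‖ :=
          (norm_mul_le _ _).trans (by gcongr; exact norm_mul_le _ _)
      _ ≤ 1 * ‖sliceLeft T k k‖ * 1 := by
          rw [norm_star]
          gcongr <;> exact hV1 _
      _ = ‖sliceLeft T k k‖ := by ring
  obtain ⟨B, hB⟩ := exists_average m (norm_nonneg _) hWn (continuous_inner_of_diag fun y => by
    simp only [hWin]
    exact Complex.continuous_ofReal.comp (orbitFun hV hT k y).continuous)
  replace hB : ∀ y, inner ℂ y (B y) = (m (orbitFun hV hT k y) : ℂ) := fun y => hB y _ (hWin y)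
  have hBsa : IsSelfAdjoint B := (isPositive_of_inner fun y =>
    ⟨_, hB y, hm.nonneg _ (orbitFun_nonneg hV hT k y)⟩).isSelfAdjoint
  -- Invariance of the mean makes the quadratic form of `B` invariant under `V`; Schur's lemma then
  -- makes it constant on spheres, and `x` is compared with `‖x‖ x₀`.
  have hcomm : ∀ g, Commute B (V g) := fun g => commute_of_inner_map_eq (hV.unitary_mem g)
    fun y => by rw [hB, hB, orbitFun_map, hm.map_mulLeft]
  have h := hirr.inner_self_eq hBsa hcomm (x := x) (y := (‖x‖ : ℂ) • x₀) (by
    rw [norm_smul, hx₀, mul_one, Complex.norm_real, norm_norm])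
  rw [map_smul, inner_smul_left, inner_smul_right, hB, hB, Complex.conj_ofReal] at h
  norm_cast at h
  rw [h, sq, mul_assoc]

-- `S` is the weak average of the slices of `T` along the orbit of one unit vector `x₀`;
-- irreducibility removes the dependence on `x₀`. The right-hand side is the quadratic form of `S ⊗
-- 1` at `k ⊗ x`.
include hm in
theorem IsInvariantMean.exists_test [CompleteSpace E] (hirr : IsIrreducibleRep V) :
    ∃ S : E →L[ℂ] E, IsTest S ∧
      ∀ k x, m (orbitFun hV hT k x) = ‖x‖ ^ 2 * (inner ℂ k (S k) : ℂ).re := by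
  have := hirr.1
  obtain ⟨x₀, hx₀⟩ := exists_norm_eq F zero_le_one
  have hWin : ∀ k g, inner ℂ k (sliceRight T (V g⁻¹ x₀) (V g⁻¹ x₀) k) =
      (orbitFun hV hT k x₀ g : ℂ) := fun k g => by
    rw [← coe_orbitFun_apply, inner_sliceRight]
  obtain ⟨S, hS⟩ := exists_average m (norm_nonneg T)
    (W := fun g : G => sliceRight T (V g⁻¹ x₀) (V g⁻¹ x₀))
    (fun g => (norm_sliceRight_le T _ _).trans_eq (by rw [hV.norm_map, hx₀, mul_one, mul_one]))
    (continuous_inner_of_diag fun k => by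
      simp only [hWin]
      exact Complex.continuous_ofReal.comp (orbitFun hV hT k x₀).continuous)
  replace hS : ∀ k, inner ℂ k (S k) = (m (orbitFun hV hT k x₀) : ℂ) := fun k =>
    hS k _ (hWin k)
  refine ⟨S, isTest_iff.2 fun k => ⟨_, hS k, hm.nonneg _ (orbitFun_nonneg hV hT k x₀),
    hm.map_le fun g => ?_⟩, fun k x => ?_⟩
  · simpa [hx₀] using orbitFun_le hV hT k x₀ g
  · rw [hm.map_orbitFun hV hT hirr k hx₀, hS, Complex.ofReal_re]

include hV hT in
/-- Averaging over an amenable group acting irreducibly on the second system reduces a test to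
one on the first system, whose rejection probabilities are averages of the original ones. -/
theorem IsAmenable.exists_averaged_test [CompleteSpace E] (hG : IsAmenable G)
    (hirr : IsIrreducibleRep V) :
    ∃ S : E →L[ℂ] E, IsTest S ∧ ∀ ρ σ, IsState ρ → IsState σ → ∀ a,
      ((∀ g, rejectProb (opTensor ρ (V g * σ * star (V g))) T ≤ a) → rejectProb ρ S ≤ a) ∧
      ((∀ g, a ≤ rejectProb (opTensor ρ (V g * σ * star (V g))) T) → a ≤ rejectProb ρ S) := by
  obtain ⟨m, hm⟩ := hG.exists_isInvariantMean
  obtain ⟨S, hS, hmS⟩ := hm.exists_test hV hT hirr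
  refine ⟨S, hS, fun ρ σ hρ hσ a => ?_⟩
  obtain ⟨v, hv⟩ := hρ.exists_isEnsemble
  obtain ⟨w, hw⟩ := hσ.exists_isEnsemble
  -- Summability in sup norm, rather than pointwise, is what allows `m` to be applied term by term.
  have hsum : Summable fun i : stdIndex E × stdIndex F => orbitFun hV hT (v i.1) (w i.2) :=
    .of_norm_bounded (hv.hasSum_norm_sq.summable.mul_of_nonneg hw.hasSum_norm_sq.summable
      (fun _ => sq_nonneg _) fun _ => sq_nonneg _) fun i => norm_orbitFun_le hV hT _ _
  obtain ⟨f, hf⟩ := hsum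
  have hfg : ∀ g, f g = rejectProb (opTensor ρ (V g⁻¹ * σ * star (V g⁻¹))) T := fun g =>
    (hf.mapL (BoundedContinuousFunction.evalCLM ℝ g)).unique
      ((hv.tmul (hw.conj (hV.unitary_mem g⁻¹))).hasSum_rejectProb T)
  have hmf : m f = rejectProb ρ S := by
    have h1 : HasSum (fun i : stdIndex E × stdIndex F =>
        ‖w i.2‖ ^ 2 * (inner ℂ (v i.1) (S (v i.1)) : ℂ).re) (m f) := by
      simp only [← hmS]
      exact hf.mapL m
    refine HasSum.unique (h1.prod_fiberwise fun i => ?_) (hv.hasSum_rejectProb S)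
    simpa using hw.hasSum_norm_sq.mul_right (inner ℂ (v i) (S (v i)) : ℂ).re
  rw [← hmf]
  exact ⟨fun h => hm.map_le fun g => hfg g ▸ h g⁻¹, fun h => hm.le_map fun g => hfg g ▸ h g⁻¹⟩

end HuntStein

/-! ### Comparison of testing problems -/

section Reduction

theorem IsEnsemble.rejectProb_mem_Icc {ι H : Type*} [NormedAddCommGroup H]
    [InnerProductSpace ℂ H] [CompleteSpace H] {v : ι → H} {ρ T : H →L[ℂ] H}
    (hv : IsEnsemble v ρ) (hT : IsTest T) : rejectProb ρ T ∈ Set.Icc (0 : ℝ) 1 :=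
  ⟨(hv.hasSum_rejectProb T).nonneg fun _ => hT.re_inner_nonneg _,
    hasSum_le (fun _ => hT.re_inner_le _) (hv.hasSum_rejectProb T) hv.hasSum_norm_sq⟩

theorem unitaryConj_star_right {H : Type*} [NormedAddCommGroup H] [InnerProductSpace ℂ H]
    [CompleteSpace H] (U : unitary (H →L[ℂ] H)) (T : H →L[ℂ] H) :
    unitaryConj U (unitaryConj (star U) T) = T := by
  have h1 : star (U : H →L[ℂ] H) * (U : H →L[ℂ] H) = 1 := Unitary.star_mul_self_of_mem U.2
  simp only [unitaryConj, Unitary.coe_star, star_star]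
  rw [mul_assoc, mul_assoc, mul_assoc, h1, mul_one, ← mul_assoc, h1, one_mul]

theorem rejectProb_unitaryConj_left {ι H : Type*} [NormedAddCommGroup H] [InnerProductSpace ℂ H]
    [CompleteSpace H] (U : unitary (H →L[ℂ] H)) {v : ι → H} {ρ : H →L[ℂ] H}
    (hv : IsEnsemble v ρ) (T : H →L[ℂ] H) :
    rejectProb (unitaryConj U ρ) T = rejectProb ρ (unitaryConj (star U) T) := by
  rw [← rejectProb_unitaryConj U hv, unitaryConj_star_right]

variable {H H' : Type*} [NormedAddCommGroup H] [InnerProductSpace ℂ H] [CompleteSpace H]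
  [NormedAddCommGroup H'] [InnerProductSpace ℂ H'] [CompleteSpace H']
variable {Θ Ξ Ξ' : Type*} {ρ : Θ → Ξ → H →L[ℂ] H} {ρ' : Θ → Ξ' → H' →L[ℂ] H'}
  {Θ₀ Θ₁ : Set Θ} {α : ℝ}

/-- The rejection probabilities of the test `S` lie between the extreme values of those of the
test `T'` with respect to the disturbance parameter. -/
def IsIntermediate (ρ : Θ → Ξ → H →L[ℂ] H) (ρ' : Θ → Ξ' → H' →L[ℂ] H') (S : H →L[ℂ] H)
    (T' : H' →L[ℂ] H') : Prop :=
  ∀ θ ξ a, ((∀ ξ', rejectProb (ρ' θ ξ') T' ≤ a) → rejectProb (ρ θ ξ) S ≤ a) ∧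
    ((∀ ξ', a ≤ rejectProb (ρ' θ ξ') T') → a ≤ rejectProb (ρ θ ξ) S)

theorem IsIntermediate.mem_levelTests {S : H →L[ℂ] H} {T' : H' →L[ℂ] H'}
    (h : IsIntermediate ρ ρ' S T') (hS : IsTest S) (hT' : T' ∈ levelTests Θ₀ ρ' α) :
    S ∈ levelTests Θ₀ ρ α :=
  ⟨hS, fun θ hθ ξ => (h θ ξ α).1 (hT'.2 θ hθ)⟩

theorem IsIntermediate.typeIIError_le {S : H →L[ℂ] H} {T' : H' →L[ℂ] H'}
    (h : IsIntermediate ρ ρ' S T') {θ : Θ} {a : ℝ}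
    (ha : ∀ ξ', typeIIError (ρ' θ ξ') T' ≤ a) (ξ : Ξ) : typeIIError (ρ θ ξ) S ≤ a := by
  have := (h θ ξ (1 - a)).2 fun ξ' => by linarith [ha ξ', typeIIError.eq_1 (ρ' θ ξ') T']
  rw [typeIIError]
  linarith

theorem IsIntermediate.mem_unbiasedTests {S : H →L[ℂ] H} {T' : H' →L[ℂ] H'}
    (h : IsIntermediate ρ ρ' S T') (hS : IsTest S) (hT' : T' ∈ unbiasedTests Θ₀ Θ₁ ρ' α) :
    S ∈ unbiasedTests Θ₀ Θ₁ ρ α :=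
  ⟨h.mem_levelTests hS hT'.1, fun θ hθ ξ => h.typeIIError_le (hT'.2 θ hθ) ξ⟩

/-- The map `Φ` embeds the tests of the problem `ρ` into those of the problem `ρ'`; the
disturbance parameter of the problem `ρ` is the image under `π` of the one of `ρ'`. -/
structure IsTestEmbedding (ρ : Θ → Ξ → H →L[ℂ] H) (ρ' : Θ → Ξ' → H' →L[ℂ] H')
    (Φ : (H →L[ℂ] H) → H' →L[ℂ] H') (π : Ξ' → Ξ) : Prop where
  surjective : Function.Surjective π
  isTest_iff : ∀ T, IsTest (Φ T) ↔ IsTest T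
  rejectProb_eq : ∀ T θ ξ', rejectProb (ρ' θ ξ') (Φ T) = rejectProb (ρ θ (π ξ')) T
  rejectProb_mem_Icc : ∀ θ ξ' T', IsTest T' → rejectProb (ρ' θ ξ') T' ∈ Set.Icc (0 : ℝ) 1

namespace IsTestEmbedding

variable {Φ : (H →L[ℂ] H) → H' →L[ℂ] H'} {π : Ξ' → Ξ} (h : IsTestEmbedding ρ ρ' Φ π)

include h

theorem typeIIError_eq (T : H →L[ℂ] H) (θ : Θ) (ξ' : Ξ') :
    typeIIError (ρ' θ ξ') (Φ T) = typeIIError (ρ θ (π ξ')) T := by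
  rw [typeIIError, typeIIError, h.rejectProb_eq]

theorem mem_levelTests_iff (T : H →L[ℂ] H) :
    Φ T ∈ levelTests Θ₀ ρ' α ↔ T ∈ levelTests Θ₀ ρ α := by
  simp only [levelTests, Set.mem_ofPred_eq, h.isTest_iff, h.rejectProb_eq, h.surjective.forall]

theorem mem_unbiasedTests_iff (T : H →L[ℂ] H) :
    Φ T ∈ unbiasedTests Θ₀ Θ₁ ρ' α ↔ T ∈ unbiasedTests Θ₀ Θ₁ ρ α := by
  simp only [unbiasedTests, Set.mem_ofPred_eq, h.mem_levelTests_iff, h.typeIIError_eq,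
    h.surjective.forall]

theorem typeIIError_mem_Icc {T' : H' →L[ℂ] H'} (hT' : IsTest T') (θ : Θ) (ξ' : Ξ') :
    typeIIError (ρ' θ ξ') T' ∈ Set.Icc (0 : ℝ) 1 := by
  obtain ⟨h0, h1⟩ := h.rejectProb_mem_Icc θ ξ' T' hT'
  constructor <;> rw [typeIIError] <;> linarith

/-- Optimality is tested at each `ξ'` separately, so the reduced test may depend on `ξ'`, but its
error there must match exactly. -/
theorem isUMPIn_iff {𝒯 : Set (H →L[ℂ] H)} {𝒯' : Set (H' →L[ℂ] H')}
    (hmem : ∀ T, Φ T ∈ 𝒯' ↔ T ∈ 𝒯)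
    (hred : ∀ T' ∈ 𝒯', ∀ ξ', ∃ S ∈ 𝒯, ∀ θ,
      typeIIError (ρ θ (π ξ')) S = typeIIError (ρ' θ ξ') T') (T : H →L[ℂ] H) :
    IsUMPIn 𝒯 Θ₁ ρ T ↔ IsUMPIn 𝒯' Θ₁ ρ' (Φ T) := by
  refine and_congr (hmem T).symm ⟨fun hT T' hT' θ hθ ξ' => ?_, fun hT S hS θ hθ ξ => ?_⟩
  · obtain ⟨S, hS, hSe⟩ := hred T' hT' ξ'
    rw [h.typeIIError_eq, ← hSe]
    exact hT S hS θ hθ _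
  · obtain ⟨ξ', rfl⟩ := h.surjective ξ
    have := hT (Φ S) ((hmem S).2 hS) θ hθ ξ'
    rwa [h.typeIIError_eq, h.typeIIError_eq] at this

/-- The two min-max values coincide: the embedding gives one inequality, the reduction the other.
The bounds in `[0, 1]` and the nonemptiness of the classes keep the real suprema and infima from
taking default values. -/
theorem isMinMaxIn_iff [Nonempty Ξ] {𝒯 : Set (H →L[ℂ] H)} {𝒯' : Set (H' →L[ℂ] H')}
    (htest : ∀ T' ∈ 𝒯', IsTest T') (hmem : ∀ T, Φ T ∈ 𝒯' ↔ T ∈ 𝒯)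
    (hred : ∀ T' ∈ 𝒯', ∃ S ∈ 𝒯, IsIntermediate ρ ρ' S T') (T : H →L[ℂ] H) :
    IsMinMaxIn 𝒯 Θ₁ ρ T ↔ IsMinMaxIn 𝒯' Θ₁ ρ' (Φ T) := by
  have hne' : Nonempty Ξ' := h.surjective.nonempty
  have hsup : ∀ (S : H →L[ℂ] H) θ,
      ⨆ ξ', typeIIError (ρ' θ ξ') (Φ S) = ⨆ ξ, typeIIError (ρ θ ξ) S := fun S θ => by
    simp only [h.typeIIError_eq]
    exact h.surjective.iSup_comp fun ξ => typeIIError (ρ θ ξ) S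
  have hbdd : ∀ T' ∈ 𝒯', ∀ θ, BddAbove (Set.range fun ξ' => typeIIError (ρ' θ ξ') T') :=
    fun T' hT' θ => ⟨1, by
      rintro _ ⟨ξ', rfl⟩
      exact (h.typeIIError_mem_Icc (htest T' hT') θ ξ').2⟩
  have hnonneg : ∀ T' ∈ 𝒯', ∀ θ, 0 ≤ ⨆ ξ', typeIIError (ρ' θ ξ') T' := fun T' hT' θ =>
    Real.iSup_nonneg fun ξ' => (h.typeIIError_mem_Icc (htest T' hT') θ ξ').1
  unfold IsMinMaxIn
  rw [hmem T]
  refine and_congr_right fun hT => forall₂_congr fun θ _ => ?_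
  rw [hsup]
  have hne : Nonempty 𝒯 := ⟨⟨T, hT⟩⟩
  have hne2 : Nonempty 𝒯' := ⟨⟨Φ T, (hmem T).2 hT⟩⟩
  have hinf : ⨅ S : 𝒯, ⨆ ξ, typeIIError (ρ θ ξ) (S : H →L[ℂ] H) =
      ⨅ T' : 𝒯', ⨆ ξ', typeIIError (ρ' θ ξ') (T' : H' →L[ℂ] H') := by
    refine le_antisymm (le_ciInf fun T' => ?_) (le_ciInf fun S => ?_)
    · obtain ⟨S, hS, hint⟩ := hred T' T'.2
      have hlow : BddBelow (Set.range fun S : 𝒯 => ⨆ ξ, typeIIError (ρ θ ξ) (S : H →L[ℂ] H)) :=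
        ⟨0, by
          rintro _ ⟨S, rfl⟩
          exact (hnonneg (Φ S) ((hmem S).2 S.2) θ).trans_eq (hsup S θ)⟩
      refine (ciInf_le hlow ⟨S, hS⟩).trans (ciSup_le fun ξ => ?_)
      exact hint.typeIIError_le (fun ξ' => le_ciSup (hbdd T' T'.2 θ) ξ') ξ
    · have hlow : BddBelow (Set.range fun T' : 𝒯' =>
          ⨆ ξ', typeIIError (ρ' θ ξ') (T' : H' →L[ℂ] H')) :=
        ⟨0, by
          rintro _ ⟨T', rfl⟩
          exact hnonneg T' T'.2 θ⟩
      exact (ciInf_le hlow ⟨Φ S, (hmem S).2 S.2⟩).trans_eq (hsup S θ)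
  rw [hinf]

theorem isUMPMinMax_iff [Nonempty Ξ]
    (hred : ∀ T', IsTest T' → ∃ S, IsTest S ∧ IsIntermediate ρ ρ' S T') (T : H →L[ℂ] H) :
    (IsUMPMinMax Θ₀ Θ₁ α ρ T ↔ IsUMPMinMax Θ₀ Θ₁ α ρ' (Φ T)) ∧
      (IsUMPUnbiasedMinMax Θ₀ Θ₁ α ρ T ↔ IsUMPUnbiasedMinMax Θ₀ Θ₁ α ρ' (Φ T)) := by
  refine ⟨h.isMinMaxIn_iff (fun T' hT' => hT'.1) h.mem_levelTests_iff (fun T' hT' => ?_) T,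
    h.isMinMaxIn_iff (fun T' hT' => hT'.1.1) h.mem_unbiasedTests_iff (fun T' hT' => ?_) T⟩
  · obtain ⟨S, hS, hint⟩ := hred T' hT'.1
    exact ⟨S, hint.mem_levelTests hS hT', hint⟩
  · obtain ⟨S, hS, hint⟩ := hred T' hT'.1.1
    exact ⟨S, hint.mem_unbiasedTests hS hT', hint⟩

theorem isUMP_iff
    (hred : ∀ T', IsTest T' → ∀ ξ', ∃ S, IsTest S ∧ IsIntermediate ρ ρ' S T' ∧
      ∀ θ, rejectProb (ρ θ (π ξ')) S = rejectProb (ρ' θ ξ') T') (T : H →L[ℂ] H) :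
    (IsUMP Θ₀ Θ₁ α ρ T ↔ IsUMP Θ₀ Θ₁ α ρ' (Φ T)) ∧
      (IsUMPUnbiased Θ₀ Θ₁ α ρ T ↔ IsUMPUnbiased Θ₀ Θ₁ α ρ' (Φ T)) := by
  refine ⟨h.isUMPIn_iff h.mem_levelTests_iff (fun T' hT' ξ' => ?_) T,
    h.isUMPIn_iff h.mem_unbiasedTests_iff (fun T' hT' ξ' => ?_) T⟩
  · obtain ⟨S, hS, hint, he⟩ := hred T' hT'.1 ξ'
    exact ⟨S, hint.mem_levelTests hS hT', fun θ => by rw [typeIIError, typeIIError, he]⟩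
  · obtain ⟨S, hS, hint, he⟩ := hred T' hT'.1.1 ξ'
    exact ⟨S, hint.mem_unbiasedTests hS hT', fun θ => by rw [typeIIError, typeIIError, he]⟩

end IsTestEmbedding

end Reduction

/-! ### Reduction of composite testing problems -/

section Composite

theorem IsState.nontrivial {H : Type*} [NormedAddCommGroup H] [InnerProductSpace ℂ H]
    [CompleteSpace H] {ρ : H →L[ℂ] H} (hρ : IsState ρ) : Nontrivial H := by
  by_contra h
  rw [not_nontrivial_iff_subsingleton] at h
  obtain ⟨v, hv⟩ := hρ.exists_isEnsemble
  have h0 : (fun i => ‖v i‖ ^ 2) = fun _ => 0 := by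
    funext i
    rw [Subsingleton.elim (v i) 0, norm_zero, zero_pow two_ne_zero]
  exact one_ne_zero (hv.hasSum_norm_sq.unique (h0 ▸ hasSum_zero))

variable {H₁ H₂ H₃ : Type*}
  [NormedAddCommGroup H₁] [InnerProductSpace ℂ H₁] [CompleteSpace H₁]
  [NormedAddCommGroup H₂] [InnerProductSpace ℂ H₂] [CompleteSpace H₂]
  [NormedAddCommGroup H₃] [InnerProductSpace ℂ H₃] [CompleteSpace H₃]
  {Θ Ξ₁ Ξ₂ Ξ₃ : Type*}
  {ρ₁ : Θ → Ξ₁ → H₁ →L[ℂ] H₁} {ρ₂ : Ξ₂ → H₂ →L[ℂ] H₂} {ρ₃ : Θ → Ξ₁ → Ξ₃ → H₃ →L[ℂ] H₃}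

theorem isTestEmbedding_tensor [Nonempty Ξ₂]
    (hρ₁ : ∀ θ ξ₁, IsState (ρ₁ θ ξ₁)) (hρ₂ : ∀ ξ₂, IsState (ρ₂ ξ₂))
    (U : unitary (HilbertTensor H₁ H₂ →L[ℂ] HilbertTensor H₁ H₂)) :
    IsTestEmbedding ρ₁ (fun θ (ξ : Ξ₁ × Ξ₂) => unitaryConj U (opTensor (ρ₁ θ ξ.1) (ρ₂ ξ.2)))
      (fun T => unitaryConj U (opTensor T 1)) Prod.fst where
  surjective := Prod.fst_surjective
  isTest_iff T := by
    have := (hρ₂ (Classical.arbitrary Ξ₂)).nontrivial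
    rw [isTest_unitaryConj, isTest_opTensor_one]
  rejectProb_eq T θ ξ := by
    obtain ⟨v, hv⟩ := (hρ₁ θ ξ.1).exists_isEnsemble
    obtain ⟨w, hw⟩ := (hρ₂ ξ.2).exists_isEnsemble
    rw [rejectProb_unitaryConj U (hv.tmul hw), rejectProb_opTensor_one hv hw]
  rejectProb_mem_Icc θ ξ T' hT' := by
    obtain ⟨v, hv⟩ := (hρ₁ θ ξ.1).exists_isEnsemble
    obtain ⟨w, hw⟩ := (hρ₂ ξ.2).exists_isEnsemble
    rw [rejectProb_unitaryConj_left U (hv.tmul hw)]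
    exact (hv.tmul hw).rejectProb_mem_Icc ((isTest_unitaryConj _).2 hT')

/-- One partial trace serves all `θ` and `ξ₁` at once, because the second state involves neither. -/
theorem exists_test_tensor (hρ₁ : ∀ θ ξ₁, IsState (ρ₁ θ ξ₁)) (hρ₂ : ∀ ξ₂, IsState (ρ₂ ξ₂))
    (U : unitary (HilbertTensor H₁ H₂ →L[ℂ] HilbertTensor H₁ H₂))
    (T' : HilbertTensor H₁ H₂ →L[ℂ] HilbertTensor H₁ H₂) (hT' : IsTest T') (ξ₂ : Ξ₂) :
    ∃ S, IsTest S ∧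
      IsIntermediate ρ₁ (fun θ (ξ : Ξ₁ × Ξ₂) => unitaryConj U (opTensor (ρ₁ θ ξ.1) (ρ₂ ξ.2)))
        S T' ∧
      ∀ θ ξ₁, rejectProb (ρ₁ θ ξ₁) S =
        rejectProb (unitaryConj U (opTensor (ρ₁ θ ξ₁) (ρ₂ ξ₂))) T' := by
  obtain ⟨S, hS, he⟩ :=
    exists_partial_test ((isTest_unitaryConj (star U)).2 hT') (hρ₂ ξ₂)
  have he' : ∀ θ ξ₁, rejectProb (ρ₁ θ ξ₁) S =
      rejectProb (unitaryConj U (opTensor (ρ₁ θ ξ₁) (ρ₂ ξ₂))) T' := fun θ ξ₁ => by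
    obtain ⟨v, hv⟩ := (hρ₁ θ ξ₁).exists_isEnsemble
    obtain ⟨w, hw⟩ := (hρ₂ ξ₂).exists_isEnsemble
    rw [rejectProb_unitaryConj_left U (hv.tmul hw), he _ (hρ₁ θ ξ₁)]
  refine ⟨S, hS, fun θ ξ₁ a => ?_, he'⟩
  rw [he']
  exact ⟨fun h => h (ξ₁, ξ₂), fun h => h (ξ₁, ξ₂)⟩

theorem isTestEmbedding_tensor_tensor [Nonempty Ξ₂] [Nonempty Ξ₃] [Nontrivial H₃]
    (hρ₁ : ∀ θ ξ₁, IsState (ρ₁ θ ξ₁)) (hρ₂ : ∀ ξ₂, IsState (ρ₂ ξ₂))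
    (hρ₃ : ∀ θ ξ₁ ξ₃, IsState (ρ₃ θ ξ₁ ξ₃))
    (U : unitary (HilbertTensor (HilbertTensor H₁ H₂) H₃ →L[ℂ]
      HilbertTensor (HilbertTensor H₁ H₂) H₃)) :
    IsTestEmbedding ρ₁
      (fun θ (ξ : Ξ₁ × Ξ₂ × Ξ₃) =>
        unitaryConj U (opTensor (opTensor (ρ₁ θ ξ.1) (ρ₂ ξ.2.1)) (ρ₃ θ ξ.1 ξ.2.2)))
      (fun T => unitaryConj U (opTensor (opTensor T 1) 1)) Prod.fst where
  surjective := Prod.fst_surjective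
  isTest_iff T := by
    have := (hρ₂ (Classical.arbitrary Ξ₂)).nontrivial
    rw [isTest_unitaryConj, isTest_opTensor_one, isTest_opTensor_one]
  rejectProb_eq T θ ξ := by
    obtain ⟨u, hu⟩ := (hρ₁ θ ξ.1).exists_isEnsemble
    obtain ⟨v, hv⟩ := (hρ₂ ξ.2.1).exists_isEnsemble
    obtain ⟨w, hw⟩ := (hρ₃ θ ξ.1 ξ.2.2).exists_isEnsemble
    rw [rejectProb_unitaryConj U ((hu.tmul hv).tmul hw), rejectProb_opTensor_one (hu.tmul hv) hw,
      rejectProb_opTensor_one hu hv]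
  rejectProb_mem_Icc θ ξ T' hT' := by
    obtain ⟨u, hu⟩ := (hρ₁ θ ξ.1).exists_isEnsemble
    obtain ⟨v, hv⟩ := (hρ₂ ξ.2.1).exists_isEnsemble
    obtain ⟨w, hw⟩ := (hρ₃ θ ξ.1 ξ.2.2).exists_isEnsemble
    rw [rejectProb_unitaryConj_left U ((hu.tmul hv).tmul hw)]
    exact ((hu.tmul hv).tmul hw).rejectProb_mem_Icc ((isTest_unitaryConj _).2 hT')

theorem exists_test_tensor_tensor [Nonempty Ξ₂] [Nonempty Ξ₃]
    (hρ₁ : ∀ θ ξ₁, IsState (ρ₁ θ ξ₁)) (hρ₂ : ∀ ξ₂, IsState (ρ₂ ξ₂))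
    (hρ₃ : ∀ θ ξ₁ ξ₃, IsState (ρ₃ θ ξ₁ ξ₃))
    {G : Type*} [Group G] [TopologicalSpace G] [IsTopologicalGroup G] (hG : IsAmenable G)
    {V : G → H₃ →L[ℂ] H₃} (hV : IsProjectiveUnitaryRep V) (hirr : IsIrreducibleRep V)
    [MulAction G (Ξ₁ × Ξ₃)] (hcov : IsCovariant V (fun θ (ξ : Ξ₁ × Ξ₃) => ρ₃ θ ξ.1 ξ.2))
    (hinv : ∀ (g : G) (θ : Θ) (ξ : Ξ₁ × Ξ₃), ρ₁ θ (g • ξ).1 = ρ₁ θ ξ.1)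
    (U : unitary (HilbertTensor (HilbertTensor H₁ H₂) H₃ →L[ℂ]
      HilbertTensor (HilbertTensor H₁ H₂) H₃))
    (T' : HilbertTensor (HilbertTensor H₁ H₂) H₃ →L[ℂ] HilbertTensor (HilbertTensor H₁ H₂) H₃)
    (hT' : IsTest T') :
    ∃ S, IsTest S ∧ IsIntermediate ρ₁
      (fun θ (ξ : Ξ₁ × Ξ₂ × Ξ₃) =>
        unitaryConj U (opTensor (opTensor (ρ₁ θ ξ.1) (ρ₂ ξ.2.1)) (ρ₃ θ ξ.1 ξ.2.2))) S T' := by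
  obtain ⟨ξ₂⟩ := ‹Nonempty Ξ₂›
  obtain ⟨ξ₃⟩ := ‹Nonempty Ξ₃›
  obtain ⟨S₁₂, hS₁₂, h₁₂⟩ :=
    hG.exists_averaged_test hV ((isTest_unitaryConj (star U)).2 hT') hirr
  obtain ⟨S, hS, he⟩ := exists_partial_test hS₁₂ (hρ₂ ξ₂)
  refine ⟨S, hS, fun θ ξ₁ a => ?_⟩
  have hst : IsState (opTensor (ρ₁ θ ξ₁) (ρ₂ ξ₂)) := by
    obtain ⟨u, hu⟩ := (hρ₁ θ ξ₁).exists_isEnsemble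
    obtain ⟨v, hv⟩ := (hρ₂ ξ₂).exists_isEnsemble
    exact (hu.tmul hv).isState
  -- Conjugating the third state by `V g` yields the member of the large family at `g • (ξ₁, ξ₃)`
  -- with the same `θ`, since `ρ₁` is constant on orbits; bounds over the disturbance parameter thus
  -- apply along the orbit.
  have key : ∀ g : G, rejectProb (opTensor (opTensor (ρ₁ θ ξ₁) (ρ₂ ξ₂))
      (V g * ρ₃ θ ξ₁ ξ₃ * star (V g))) (unitaryConj (star U) T') =
      rejectProb (unitaryConj U (opTensor (opTensor (ρ₁ θ (g • (ξ₁, ξ₃)).1) (ρ₂ ξ₂))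
        (ρ₃ θ (g • (ξ₁, ξ₃)).1 (g • (ξ₁, ξ₃)).2))) T' := fun g => by
    obtain ⟨u, hu⟩ := (hρ₁ θ (g • (ξ₁, ξ₃)).1).exists_isEnsemble
    obtain ⟨v, hv⟩ := (hρ₂ ξ₂).exists_isEnsemble
    obtain ⟨w, hw⟩ := (hρ₃ θ (g • (ξ₁, ξ₃)).1 (g • (ξ₁, ξ₃)).2).exists_isEnsemble
    rw [rejectProb_unitaryConj_left U ((hu.tmul hv).tmul hw), hinv]
    exact congrArg (fun σ => rejectProb (opTensor _ σ) _) (hcov g θ (ξ₁, ξ₃))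
  rw [he _ (hρ₁ θ ξ₁)]
  have h := h₁₂ _ _ hst (hρ₃ θ ξ₁ ξ₃) a
  simp only [key] at h
  exact ⟨fun h' => h.1 fun g => h' (_, ξ₂, _), fun h' => h.2 fun g => h' (_, ξ₂, _)⟩

end Composite

theorem mainTheorem1
    {H₁ H₂ : Type*}
    [NormedAddCommGroup H₁] [InnerProductSpace ℂ H₁] [CompleteSpace H₁]
    [TopologicalSpace.SeparableSpace H₁]
    [NormedAddCommGroup H₂] [InnerProductSpace ℂ H₂] [CompleteSpace H₂]
    [TopologicalSpace.SeparableSpace H₂]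
    {Θ Ξ₁ Ξ₂ : Type*} [Nonempty Ξ₁] [Nonempty Ξ₂]
    (Θ₀ Θ₁ : Set Θ) (hdisj : Disjoint Θ₀ Θ₁) (hunion : Θ₀ ∪ Θ₁ = Set.univ)
    (α : ℝ) (hα₀ : 0 < α) (hα₁ : α < 1)
    (ρ₁ : Θ → Ξ₁ → H₁ →L[ℂ] H₁) (hρ₁ : ∀ θ ξ₁, IsState (ρ₁ θ ξ₁))
    (ρ₂ : Ξ₂ → H₂ →L[ℂ] H₂) (hρ₂ : ∀ ξ₂, IsState (ρ₂ ξ₂)) :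
    -- the reduction with three systems, for the min-max criteria
    (∀ {H₃ : Type*}
      [NormedAddCommGroup H₃] [InnerProductSpace ℂ H₃] [CompleteSpace H₃]
      [TopologicalSpace.SeparableSpace H₃]
      {Ξ₃ : Type*} [Nonempty Ξ₃]
      (ρ₃ : Θ → Ξ₁ → Ξ₃ → H₃ →L[ℂ] H₃) (_ : ∀ θ ξ₁ ξ₃, IsState (ρ₃ θ ξ₁ ξ₃))
      {G : Type*} [Group G] [TopologicalSpace G] [IsTopologicalGroup G]
      [LocallyCompactSpace G] [T2Space G] (_ : IsAmenable G)
      (V : G → H₃ →L[ℂ] H₃) (_ : IsProjectiveUnitaryRep V) (_ : IsIrreducibleRep V)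
      -- the covariance with respect to `Ξ₁ × Ξ₃`; the action leaves the first family unchanged
      [MulAction G (Ξ₁ × Ξ₃)]
      (_ : IsCovariant V (fun θ (ξ : Ξ₁ × Ξ₃) => ρ₃ θ ξ.1 ξ.2))
      (_ : ∀ (g : G) (θ : Θ) (ξ : Ξ₁ × Ξ₃), ρ₁ θ (g • ξ).1 = ρ₁ θ ξ.1)
      (_ : ¬ CompactSpace G →
        IsCompleteFamily (fun i : Θ × Ξ₁ × Ξ₃ =>
          opTensor (ρ₁ i.1 i.2.1) (ρ₃ i.1 i.2.1 i.2.2)))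
      (U : unitary (HilbertTensor (HilbertTensor H₁ H₂) H₃ →L[ℂ]
        HilbertTensor (HilbertTensor H₁ H₂) H₃))
      (T : H₁ →L[ℂ] H₁),
      (IsUMPMinMax Θ₀ Θ₁ α ρ₁ T ↔
        IsUMPMinMax Θ₀ Θ₁ α
          (fun θ (ξ : Ξ₁ × Ξ₂ × Ξ₃) =>
            unitaryConj U (opTensor (opTensor (ρ₁ θ ξ.1) (ρ₂ ξ.2.1)) (ρ₃ θ ξ.1 ξ.2.2)))
          (unitaryConj U (opTensor (opTensor T 1) 1))) ∧
      (IsUMPUnbiasedMinMax Θ₀ Θ₁ α ρ₁ T ↔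
        IsUMPUnbiasedMinMax Θ₀ Θ₁ α
          (fun θ (ξ : Ξ₁ × Ξ₂ × Ξ₃) =>
            unitaryConj U (opTensor (opTensor (ρ₁ θ ξ.1) (ρ₂ ξ.2.1)) (ρ₃ θ ξ.1 ξ.2.2)))
          (unitaryConj U (opTensor (opTensor T 1) 1)))) ∧
    -- the reduction without the third system, for all four criteria
    (∀ (U' : unitary (HilbertTensor H₁ H₂ →L[ℂ] HilbertTensor H₁ H₂)) (T : H₁ →L[ℂ] H₁),
      (IsUMP Θ₀ Θ₁ α ρ₁ T ↔
        IsUMP Θ₀ Θ₁ α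
          (fun θ (ξ : Ξ₁ × Ξ₂) => unitaryConj U' (opTensor (ρ₁ θ ξ.1) (ρ₂ ξ.2)))
          (unitaryConj U' (opTensor T 1))) ∧
      (IsUMPUnbiased Θ₀ Θ₁ α ρ₁ T ↔
        IsUMPUnbiased Θ₀ Θ₁ α
          (fun θ (ξ : Ξ₁ × Ξ₂) => unitaryConj U' (opTensor (ρ₁ θ ξ.1) (ρ₂ ξ.2)))
          (unitaryConj U' (opTensor T 1))) ∧
      (IsUMPMinMax Θ₀ Θ₁ α ρ₁ T ↔
        IsUMPMinMax Θ₀ Θ₁ α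
          (fun θ (ξ : Ξ₁ × Ξ₂) => unitaryConj U' (opTensor (ρ₁ θ ξ.1) (ρ₂ ξ.2)))
          (unitaryConj U' (opTensor T 1))) ∧
      (IsUMPUnbiasedMinMax Θ₀ Θ₁ α ρ₁ T ↔
        IsUMPUnbiasedMinMax Θ₀ Θ₁ α
          (fun θ (ξ : Ξ₁ × Ξ₂) => unitaryConj U' (opTensor (ρ₁ θ ξ.1) (ρ₂ ξ.2)))
          (unitaryConj U' (opTensor T 1)))) := by
  
  refine ⟨?_, fun U' T => ?_⟩
  · intro H₃ _ _ _ _ Ξ₃ _ ρ₃ hρ₃ G _ _ _ _ _ hG V hV hirr _ hcov hinv _ U T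
    have := hirr.1
    exact (isTestEmbedding_tensor_tensor hρ₁ hρ₂ hρ₃ U).isUMPMinMax_iff
      (exists_test_tensor_tensor hρ₁ hρ₂ hρ₃ hG hV hirr hcov hinv U) T
  · have h := isTestEmbedding_tensor hρ₁ hρ₂ U'
    have hred := fun T' hT' (ξ' : Ξ₁ × Ξ₂) => exists_test_tensor hρ₁ hρ₂ U' T' hT' ξ'.2
    obtain ⟨h1, h2⟩ := h.isUMP_iff (Θ₀ := Θ₀) (Θ₁ := Θ₁) (α := α) (fun T' hT' ξ' => by
      obtain ⟨S, hS, hint, he⟩ := hred T' hT' ξ'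
      exact ⟨S, hS, hint, fun θ => he θ ξ'.1⟩) T
    -- For min-max a single intermediate test is enough, so any value of `ξ₂` may be frozen.
    obtain ⟨h3, h4⟩ := h.isUMPMinMax_iff (Θ₀ := Θ₀) (Θ₁ := Θ₁) (α := α) (fun T' hT' => by
      obtain ⟨S, hS, hint, -⟩ := hred T' hT' (Classical.arbitrary _)
      exact ⟨S, hS, hint⟩) T
    exact ⟨h1, h2, h3, h4⟩
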